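/- Let $\mathfrak g$ be a real Lie algebra. A left-invariant almost Hermitian structure on $\mathfrak g$ is a pair $(g,J)$ of an inner product $g$ on $\mathfrak g$ and a linear map $J:\mathfrak g\to\mathfrak g$ with $J^2=-\mathrm{Id}$ and $g(JX,JY)=g(X,Y)$ (one says that $J$ is compatible with $g$); put $\omega(X,Y)=g(JX,Y)$. Let $\nabla$ be the Levi-Civita connection of $g$ (given on $\mathfrak g$ by the Koszul formula $2g(\nabla_XY,Z)=g([X,Y],Z)-g([Y,Z],X)+g([Z,X],Y)$) and $R_{XYZW}=g(\nabla_X\nabla_YZ-\nabla_Y\nabla_XZ-\nabla_{[X,Y]}Z,\,W)$ its curvature tensor; $g$ is flat if $R=0$. The structure $(g,J)$ is of class $\mathcal{AH}_1$ if $R_{XYZW}=R_{XY\,JZ\,JW}$ for all $X,Y,Z,W\in\mathfrak g$, and it is Kähler if the Nijenhuis tensor $N(X,Y)=[JX,JY]-[X,Y]-J[JX,Y]-J[X,JY]$ vanishes and $d\omega=0$, where $d\omega(X,Y,Z)=-\omega([X,Y],Z)-\omega([Y,Z],X)-\omega([Z,X],Y)$. Let $\mathcal A_{3,6}\oplus\mathcal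 A_1$ be the 4-dimensional real Lie algebra with basis $e_1,e_2,e_3,e_4$ whose only non-zero brackets, up to antisymmetry, are $[e_1,e_3]=-e_2$ and $[e_2,e_3]=e_1$. **Theorem.** 1. A 4-dimensional real Lie algebra admits a non-Kähler left-invariant $\mathcal{AH}_1$-structure if and only if it is isomorphic to $\mathcal A_{3,6}\oplus\mathcal A_1$. 2. The metric $\sum_{i=1}^4 e^i\otimes e^i$ on $\mathcal A_{3,6}\oplus\mathcal A_1$ is flat. 3. A left-invariant almost Hermitian structure $(g,J)$ on $\mathcal A_{3,6}\oplus\mathcal A_1$ is a non-Kähler $\mathcal{AH}_1$-structure if and only if $g$ is flat and $(g,J)$ is not Kähler. 4. Every flat left-invariant metric on $\mathcal A_{3,6}\oplus\mathcal A_1$ has a compatible almost complex structure $J$ for which $(g,J)$ is not Kähler. -/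

import Mathlib

/-!
Left-invariant almost Hermitian structures on a Lie group are described on its Lie algebra `𝔤`:
a left-invariant Riemannian metric is an inner product on `𝔤`, a left-invariant almost complex
structure is an endomorphism of `𝔤`, and all differential operations below are evaluated on
left-invariant vector fields, whose bracket is the bracket of `𝔤` and on which every
left-invariant function is constant.
-/

noncomputable section

namespace LieAH

/-- An inner product on a real vector space `V`; on a Lie algebra, a left-invariant Riemannian
metric. -/
structure Metric (V : Type*) [AddCommGroup V] [Module ℝ V] where
  form : LinearMap.BilinForm ℝ V
  symm : ∀ x y, form x y = form y x
  pos : ∀ x, x ≠ 0 → 0 < form x x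

theorem Metric.nondegenerate {V : Type*} [AddCommGroup V] [Module ℝ V] (g : Metric V) :
    g.form.Nondegenerate := by
  refine ⟨fun x hx => ?_, fun x hx => ?_⟩
  · by_contra h
    exact (g.pos x h).ne' (hx x)
  · by_contra h
    exact (g.pos x h).ne' (hx x)

/-- `J` is an almost complex structure (`J² = -Id`) orthogonal with respect to `g`. -/
structure IsCompatible {V : Type*} [AddCommGroup V] [Module ℝ V] (g : Metric V)
    (J : V →ₗ[ℝ] V) : Prop where
  sq : ∀ x, J (J x) = -x
  orthogonal : ∀ x y, g.form (J x) (J y) = g.form x y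

section

variable {𝔤 : Type*} [LieRing 𝔤] [LieAlgebra ℝ 𝔤]

/-- The right-hand side of the Koszul formula for left-invariant fields, as a linear form in `z`:
`z ↦ ½ (g([x,y],z) - g([y,z],x) + g([z,x],y))`. -/
def koszul (g : Metric 𝔤) (x y : 𝔤) : Module.Dual ℝ 𝔤 where
  toFun z := (1 / 2 : ℝ) * (g.form ⁅x, y⁆ z - g.form ⁅y, z⁆ x + g.form ⁅z, x⁆ y)
  map_add' z w := by
    simp only [map_add, lie_add, add_lie, LinearMap.add_apply]
    ring
  map_smul' c z := by
    simp only [map_smul, lie_smul, smul_lie, LinearMap.smul_apply, smul_eq_mul, RingHom.id_apply]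
    ring

variable [FiniteDimensional ℝ 𝔤]

/-- The Levi-Civita connection `∇_x y` of the left-invariant metric `g`, for left-invariant
fields `x` and `y`. -/
def nabla (g : Metric 𝔤) (x y : 𝔤) : 𝔤 :=
  (g.form.toDual g.nondegenerate).symm (koszul g x y)

theorem form_nabla (g : Metric 𝔤) (x y z : 𝔤) :
    g.form (nabla g x y) z =
      (1 / 2 : ℝ) * (g.form ⁅x, y⁆ z - g.form ⁅y, z⁆ x + g.form ⁅z, x⁆ y) := by
  rw [nabla, LinearMap.BilinForm.apply_toDual_symm_apply]
  rfl

/-- `∇` is compatible with the metric: `g(∇_x y, z) + g(y, ∇_x z) = 0`. -/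
theorem nabla_metric (g : Metric 𝔤) (x y z : 𝔤) :
    g.form (nabla g x y) z + g.form y (nabla g x z) = 0 := by
  rw [g.symm y, form_nabla, form_nabla, ← lie_skew x y, ← lie_skew x z, ← lie_skew z y]
  simp only [map_neg, LinearMap.neg_apply]
  ring

/-- `∇` is torsion-free: `∇_x y - ∇_y x = [x, y]`. -/
theorem nabla_torsion (g : Metric 𝔤) (x y : 𝔤) : nabla g x y - nabla g y x = ⁅x, y⁆ := by
  rw [← sub_eq_zero]
  refine g.nondegenerate.1 _ fun z => ?_
  simp only [map_sub, LinearMap.sub_apply, form_nabla]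
  rw [← lie_skew y x, ← lie_skew x z, ← lie_skew z y]
  simp only [map_neg, LinearMap.neg_apply]
  ring

/-- The Riemann curvature `R(x,y)z = ∇_x ∇_y z - ∇_y ∇_x z - ∇_{[x,y]} z`. -/
def curvature (g : Metric 𝔤) (x y z : 𝔤) : 𝔤 :=
  nabla g x (nabla g y z) - nabla g y (nabla g x z) - nabla g ⁅x, y⁆ z

/-- The curvature tensor `R_{xyzw} = g(R(x,y)z, w)`. -/
def curvatureTensor (g : Metric 𝔤) (x y z w : 𝔤) : ℝ :=
  g.form (curvature g x y z) w

/-- The metric is flat: its Riemann curvature vanishes identically. -/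
def IsFlat (g : Metric 𝔤) : Prop := ∀ x y z, curvature g x y z = 0

/-- The first Gray condition `R_{xyzw} = R_{xy JzJw}`, defining the class `AH₁`. -/
def IsAH1 (g : Metric 𝔤) (J : 𝔤 →ₗ[ℝ] 𝔤) : Prop :=
  ∀ x y z w, curvatureTensor g x y z w = curvatureTensor g x y (J z) (J w)

end

section

variable {𝔤 : Type*} [LieRing 𝔤] [LieAlgebra ℝ 𝔤]

/-- The Nijenhuis tensor of `J`. -/
def nijenhuis (J : 𝔤 →ₗ[ℝ] 𝔤) (x y : 𝔤) : 𝔤 :=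
  ⁅J x, J y⁆ - ⁅x, y⁆ - J ⁅J x, y⁆ - J ⁅x, J y⁆

/-- The fundamental form `ω(x,y) = g(Jx,y)`. -/
def omega (g : Metric 𝔤) (J : 𝔤 →ₗ[ℝ] 𝔤) (x y : 𝔤) : ℝ := g.form (J x) y

/-- The exterior derivative of the left-invariant 2-form `ω` on left-invariant fields. -/
def dOmega (g : Metric 𝔤) (J : 𝔤 →ₗ[ℝ] 𝔤) (x y z : 𝔤) : ℝ :=
  -omega g J ⁅x, y⁆ z - omega g J ⁅y, z⁆ x - omega g J ⁅z, x⁆ y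

/-- `(g, J)` is Kähler: `J` is integrable and `ω` is closed. -/
def IsKahler (g : Metric 𝔤) (J : 𝔤 →ₗ[ℝ] 𝔤) : Prop :=
  (∀ x y, nijenhuis J x y = 0) ∧ ∀ x y z, dOmega g J x y z = 0

end

/-- The Lie algebra `A_{3,6} ⊕ A_1`: it has a basis `e₁, e₂, e₃, e₄` whose only non-zero brackets
are `[e₁,e₃] = -e₂`, `[e₂,e₃] = e₁` and those that follow by antisymmetry. An element
`c1 e₁ + c2 e₂ + c3 e₃ + c4 e₄` is given by its coordinates. -/
@[ext]
structure A36A1 where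
  c1 : ℝ
  c2 : ℝ
  c3 : ℝ
  c4 : ℝ

namespace A36A1

instance : Zero A36A1 := ⟨⟨0, 0, 0, 0⟩⟩

instance : Add A36A1 := ⟨fun x y => ⟨x.c1 + y.c1, x.c2 + y.c2, x.c3 + y.c3, x.c4 + y.c4⟩⟩

instance : Neg A36A1 := ⟨fun x => ⟨-x.c1, -x.c2, -x.c3, -x.c4⟩⟩

instance : SMul ℝ A36A1 := ⟨fun a x => ⟨a * x.c1, a * x.c2, a * x.c3, a * x.c4⟩⟩

instance : Bracket A36A1 A36A1 :=
  ⟨fun x y => ⟨x.c2 * y.c3 - x.c3 * y.c2, -(x.c1 * y.c3 - x.c3 * y.c1), 0, 0⟩⟩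

theorem zero_def : (0 : A36A1) = ⟨0, 0, 0, 0⟩ := rfl

theorem add_def (x y : A36A1) :
    x + y = ⟨x.c1 + y.c1, x.c2 + y.c2, x.c3 + y.c3, x.c4 + y.c4⟩ := rfl

theorem neg_def (x : A36A1) : -x = ⟨-x.c1, -x.c2, -x.c3, -x.c4⟩ := rfl

theorem smul_def (a : ℝ) (x : A36A1) : a • x = ⟨a * x.c1, a * x.c2, a * x.c3, a * x.c4⟩ := rfl

theorem lie_def (x y : A36A1) :
    ⁅x, y⁆ = ⟨x.c2 * y.c3 - x.c3 * y.c2, -(x.c1 * y.c3 - x.c3 * y.c1), 0, 0⟩ := rfl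

instance : AddCommGroup A36A1 where
  add_assoc x y z := by ext <;> simp only [add_def] <;> ring
  zero_add x := by ext <;> simp only [add_def, zero_def] <;> ring
  add_zero x := by ext <;> simp only [add_def, zero_def] <;> ring
  add_comm x y := by ext <;> simp only [add_def] <;> ring
  neg_add_cancel x := by ext <;> simp only [add_def, neg_def, zero_def] <;> ring
  nsmul := nsmulRec
  zsmul := zsmulRec

instance : Module ℝ A36A1 where
  one_smul x := by ext <;> simp only [smul_def] <;> ring
  mul_smul a b x := by ext <;> simp only [smul_def] <;> ring
  smul_zero a := by ext <;> simp only [smul_def, zero_def] <;> ring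
  smul_add a x y := by ext <;> simp only [smul_def, add_def] <;> ring
  add_smul a b x := by ext <;> simp only [smul_def, add_def] <;> ring
  zero_smul x := by ext <;> simp only [smul_def, zero_def] <;> ring

instance : LieRing A36A1 where
  add_lie x y z := by ext <;> simp only [lie_def, add_def] <;> ring
  lie_add x y z := by ext <;> simp only [lie_def, add_def] <;> ring
  lie_self x := by ext <;> simp only [lie_def, zero_def] <;> ring
  leibniz_lie x y z := by ext <;> simp only [lie_def, add_def] <;> ring

instance : LieAlgebra ℝ A36A1 where
  lie_smul a x y := by ext <;> simp only [lie_def, smul_def] <;> ring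

/-- The coordinates with respect to `e₁, e₂, e₃, e₄`. -/
def coordEquiv : A36A1 ≃ₗ[ℝ] (Fin 4 → ℝ) where
  toFun x := ![x.c1, x.c2, x.c3, x.c4]
  invFun v := ⟨v 0, v 1, v 2, v 3⟩
  map_add' x y := by
    ext i
    fin_cases i <;> rfl
  map_smul' a x := by
    ext i
    fin_cases i <;> rfl
  left_inv x := rfl
  right_inv v := by
    ext i
    fin_cases i <;> rfl

instance : FiniteDimensional ℝ A36A1 := Module.Finite.equiv coordEquiv.symm

theorem finrank_eq : Module.finrank ℝ A36A1 = 4 := by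
  rw [coordEquiv.finrank_eq, Module.finrank_fin_fun]

/-- The metric `∑ eⁱ ⊗ eⁱ` on `A_{3,6} ⊕ A_1`. -/
def stdMetric : Metric A36A1 where
  form := LinearMap.mk₂ ℝ
    (fun x y : A36A1 => x.c1 * y.c1 + x.c2 * y.c2 + x.c3 * y.c3 + x.c4 * y.c4)
    (fun x y z => by simp only [add_def]; ring)
    (fun c x y => by simp only [smul_def, smul_eq_mul]; ring)
    (fun x y z => by simp only [add_def]; ring)
    (fun c x y => by simp only [smul_def, smul_eq_mul]; ring)
  symm x y := by
    simp only [LinearMap.mk₂_apply]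
    ring
  pos x hx := by
    simp only [LinearMap.mk₂_apply]
    have h : x.c1 ≠ 0 ∨ x.c2 ≠ 0 ∨ x.c3 ≠ 0 ∨ x.c4 ≠ 0 := by
      by_contra! h
      exact hx (A36A1.ext h.1 h.2.1 h.2.2.1 h.2.2.2)
    rcases h with h | h | h | h <;> have := mul_self_pos.mpr h <;>
      nlinarith [mul_self_nonneg x.c1, mul_self_nonneg x.c2, mul_self_nonneg x.c3,
        mul_self_nonneg x.c4]

end A36A1

end LieAH

end

open LieAH

/-! `IsAH1` says that every curvature operator commutes with J. In a unitary frame b₀, Jb₀, b₂, Jb₂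
the self-dual part of the Levi-Civita connection is a triple of linear forms c₁, c₂, c₃ (`sd1`,
`sd2`, `sd3`), and c₂, c₃ together measure ∇J. The AH₁ condition kills two of the three self-dual
curvature components, so dc₂ = -c₃∧c₁, dc₃ = -c₁∧c₂ and dc₁ = -c₂∧c₃ + ρ with ρ = `ricciForm`. Then
d² = 0 yields c₂∧ρ = c₃∧ρ = 0.

In dimension four the three forms have a common kernel vector, taken as b₀. The main point,
`sd2_wedge_sd3`, is that c₂∧c₃ = 0. Otherwise there are two cases. If the three forms are
independent, the algebra splits orthogonally as ℝb₀ plus a 3-dimensional algebra, which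
`det_eq_zero_of_cofactor` excludes. If they span a plane, their kernel is the J-invariant plane of
b₀, b₁, which the Jacobi identity excludes (`false_of_kernel`).

So for a non-Kähler structure ∇J lives in one direction. With b₀ moved to that direction, a Bochner
argument (`coeff_eq_zero_of_rank_one`) shows that b₀ is parallel and ∇ = b⁰ ⊗ A with A skew, nonzero
and Ab₀ = 0. Such a metric is flat, and ad b₀ is a rotation about an axis, which gives A₃,₆ ⊕ A₁.
Conversely flat metrics satisfy AH₁ trivially, and `exists_isCompatible_not_isKahler` supplies a J
with ω not closed. -/

namespace LieAH

/-! ### Levi-Civita connection and curvature symmetries -/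

section Connection

variable {𝔤 : Type*} [LieRing 𝔤] [LieAlgebra ℝ 𝔤]

theorem Metric.ext_form {V : Type*} [AddCommGroup V] [Module ℝ V] (g : Metric V) {x y : V}
    (h : ∀ z, g.form x z = g.form y z) : x = y := by
  rw [← sub_eq_zero]
  refine g.nondegenerate.1 _ fun z => ?_
  rw [map_sub, LinearMap.sub_apply, h z, sub_self]

theorem IsCompatible.form_left {V : Type*} [AddCommGroup V] [Module ℝ V]
    {g : Metric V} {J : V →ₗ[ℝ] V} (hJ : IsCompatible g J) (x y : V) :
    g.form (J x) y = -g.form x (J y) := by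
  rw [← hJ.orthogonal (J x) y, hJ.sq, map_neg, LinearMap.neg_apply]

theorem IsCompatible.form_self {V : Type*} [AddCommGroup V] [Module ℝ V]
    {g : Metric V} {J : V →ₗ[ℝ] V} (hJ : IsCompatible g J) (x : V) : g.form (J x) x = 0 := by
  have h := hJ.form_left x x
  rw [g.symm x] at h
  linarith

variable [FiniteDimensional ℝ 𝔤]

/-- The Levi-Civita connection as a bilinear map. -/
noncomputable def conn (g : Metric 𝔤) : 𝔤 →ₗ[ℝ] 𝔤 →ₗ[ℝ] 𝔤 :=
  LinearMap.mk₂ ℝ (nabla g)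
    (fun x y z => g.ext_form fun w => by
      simp only [map_add, LinearMap.add_apply, form_nabla, add_lie, lie_add]; ring)
    (fun c x y => g.ext_form fun w => by
      simp only [map_smul, LinearMap.smul_apply, form_nabla, smul_lie, lie_smul, smul_eq_mul]; ring)
    (fun x y z => g.ext_form fun w => by
      simp only [map_add, LinearMap.add_apply, form_nabla, add_lie, lie_add]; ring)
    (fun c x y => g.ext_form fun w => by
      simp only [map_smul, LinearMap.smul_apply, form_nabla, smul_lie, lie_smul, smul_eq_mul]; ring)

theorem conn_apply (g : Metric 𝔤) (x y : 𝔤) : conn g x y = nabla g x y := rfl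

theorem lie_eq_conn (g : Metric 𝔤) (x y : 𝔤) : ⁅x, y⁆ = conn g x y - conn g y x :=
  (nabla_torsion g x y).symm

theorem form_conn_left (g : Metric 𝔤) (x y z : 𝔤) :
    g.form (conn g x y) z = -g.form (conn g x z) y := by
  have := nabla_metric g x y z
  rw [g.symm y] at this
  simp only [conn_apply]
  linarith

theorem curvature_eq_conn (g : Metric 𝔤) (x y z : 𝔤) :
    curvature g x y z = conn g x (conn g y z) - conn g y (conn g x z) - conn g ⁅x, y⁆ z := rfl

/-- The first Bianchi identity. -/
theorem curvature_cyclic (g : Metric 𝔤) (x y z : 𝔤) :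
    curvature g x y z + curvature g y z x + curvature g z x y = 0 := by
  have key : ∀ a b c : 𝔤, conn g a (conn g b c) - conn g a (conn g c b) - conn g ⁅b, c⁆ a
      = ⁅a, ⁅b, c⁆⁆ := fun a b c => by
    rw [lie_eq_conn g a, ← map_sub, ← lie_eq_conn g b c]
  have h := lie_jacobi x y z
  rw [← key x y z, ← key y z x, ← key z x y] at h
  rw [← h]
  simp only [curvature_eq_conn]
  abel

theorem curvatureTensor_swap_left (g : Metric 𝔤) (x y z w : 𝔤) :
    curvatureTensor g x y z w = -curvatureTensor g y x z w := by
  simp only [curvatureTensor, curvature_eq_conn, ← lie_skew y x, map_neg, map_sub,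
    LinearMap.neg_apply, LinearMap.sub_apply]
  ring

theorem curvatureTensor_eq (g : Metric 𝔤) (x y z w : 𝔤) :
    curvatureTensor g x y z w = g.form (conn g x z) (conn g y w)
      - g.form (conn g y z) (conn g x w) - g.form (conn g ⁅x, y⁆ z) w := by
  simp only [curvatureTensor, curvature_eq_conn, map_sub, LinearMap.sub_apply]
  rw [form_conn_left g x, form_conn_left g y, g.symm (conn g x w), g.symm (conn g y w)]
  ring

theorem curvatureTensor_swap_right (g : Metric 𝔤) (x y z w : 𝔤) :
    curvatureTensor g x y z w = -curvatureTensor g x y w z := by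
  simp only [curvatureTensor_eq]
  rw [form_conn_left g ⁅x, y⁆, g.symm (conn g x z), g.symm (conn g y z)]
  ring

theorem curvatureTensor_cyclic (g : Metric 𝔤) (x y z w : 𝔤) :
    curvatureTensor g x y z w + curvatureTensor g y z x w + curvatureTensor g z x y w = 0 := by
  simp only [curvatureTensor, ← LinearMap.add_apply, ← map_add, curvature_cyclic, map_zero,
    LinearMap.zero_apply]

theorem curvatureTensor_pair (g : Metric 𝔤) (x y z w : 𝔤) :
    curvatureTensor g x y z w = curvatureTensor g z w x y := by
  have h1 := curvatureTensor_cyclic g x y z w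
  have h2 := curvatureTensor_cyclic g y z w x
  have h3 := curvatureTensor_cyclic g z w x y
  have h4 := curvatureTensor_cyclic g w x y z
  rw [curvatureTensor_swap_right g y z w x, curvatureTensor_swap_right g z w y x,
    curvatureTensor_swap_left g w y z x, curvatureTensor_swap_right g y w z x] at h2
  rw [curvatureTensor_swap_right g w x z y, curvatureTensor_swap_left g x z w y,
    curvatureTensor_swap_right g z x w y] at h3
  rw [curvatureTensor_swap_left g w x y z, curvatureTensor_swap_right g x y w z] at h4
  have h5 := curvatureTensor_swap_left g w x y z
  have h6 := curvatureTensor_swap_right g y w x z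
  linarith

/-- `x` is a direction along which `J` is parallel: `∇_x J = 0`. -/
def IsParallelAlong (g : Metric 𝔤) (J : 𝔤 →ₗ[ℝ] 𝔤) (x : 𝔤) : Prop :=
  ∀ y, conn g x (J y) = J (conn g x y)

/-- Brackets are differences of covariant derivatives, so once J passes through ∇ all terms of N and
dω cancel in pairs. -/
theorem isKahler_of_parallel {g : Metric 𝔤} {J : 𝔤 →ₗ[ℝ] 𝔤} (hJ : IsCompatible g J)
    (h : ∀ x, IsParallelAlong g J x) : IsKahler g J := by
  constructor
  · intro x y
    simp only [nijenhuis, lie_eq_conn g, h _ _, map_sub, hJ.sq]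
    abel
  · intro x y z
    have key : ∀ a b c, g.form (J (conn g a b)) c = g.form (J (conn g a c)) b := fun a b c => by
      rw [← h a b, form_conn_left, hJ.form_left, neg_inj, g.symm]
    simp only [dOmega, omega, lie_eq_conn g, map_sub, LinearMap.sub_apply]
    rw [key x y z, key y z x, key z x y]
    ring

end Connection


/-! ### Structure equations of an AH₁-structure in a unitary frame -/

section Coefficients

variable (G : Fin 4 → Fin 4 → Fin 4 → ℝ)

/-- Structure constants of a torsion-free connection with coefficients `G`. -/
def structConst (i j k : Fin 4) : ℝ := G i j k - G j i k

/-- Curvature components of a metric connection with coefficients `G` in an orthonormal frame. -/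
def curvCoeff (i j k l : Fin 4) : ℝ :=
  ∑ m, (G i k m * G j l m - G j k m * G i l m) - ∑ m, structConst G i j m * G m k l

/-- The component along `e⁰¹ + e²³` of the self-dual part of the connection. -/
def sd1 (i : Fin 4) : ℝ := G i 0 1 + G i 2 3

/-- The component along `e⁰² - e¹³` of the self-dual part of the connection. -/
def sd2 (i : Fin 4) : ℝ := G i 0 2 - G i 1 3

/-- The component along `e⁰³ + e¹²` of the self-dual part of the connection. -/
def sd3 (i : Fin 4) : ℝ := G i 0 3 + G i 1 2

/-- The Ricci-type form `R_{ij01} + R_{ij23}`. -/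
def ricciForm (i j : Fin 4) : ℝ := curvCoeff G i j 0 1 + curvCoeff G i j 2 3

/-- Connection coefficients, in a unitary frame `b₀, b₁ = J b₀, b₂, b₃ = J b₂`, of a Lie algebra
with an `AH₁`-structure. -/
structure IsAH1Coeff : Prop where
  skew : ∀ i j k, G i j k = -G i k j
  jacobi : ∀ i j k l, ∑ m, (structConst G i j m * structConst G m k l
    + structConst G j k m * structConst G m i l + structConst G k i m * structConst G m j l) = 0
  cyclic : ∀ i j k l, curvCoeff G i j k l + curvCoeff G j k i l + curvCoeff G k i j l = 0
  pair : ∀ i j k l, curvCoeff G i j k l = curvCoeff G k l i j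
  ah02 : ∀ i j, curvCoeff G i j 0 2 = curvCoeff G i j 1 3
  ah03 : ∀ i j, curvCoeff G i j 0 3 = -curvCoeff G i j 1 2

variable {G}

theorem structConst_swap (i j k : Fin 4) : structConst G i j k = -structConst G j i k := by
  simp only [structConst]; ring

theorem structConst_self (i k : Fin 4) : structConst G i i k = 0 := by
  simp only [structConst]; ring

theorem coeff_self (hG : ∀ i j k, G i j k = -G i k j) (i j : Fin 4) : G i j j = 0 := by
  linarith [hG i j j]

theorem coeff_eq_structConst (hG : ∀ i j k, G i j k = -G i k j) (i j k : Fin 4) :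
    G i j k = (structConst G i j k - structConst G j k i + structConst G k i j) / 2 := by
  simp only [structConst]
  linarith [hG j k i, hG i k j, hG k j i]

theorem ricciForm_swap (i j : Fin 4) : ricciForm G i j = -ricciForm G j i := by
  simp only [ricciForm, curvCoeff, Fin.sum_univ_four, structConst]
  ring

namespace IsAH1Coeff

/-- The structure equation dc₂ = -c₃∧c₁: the corresponding curvature component R₀₂ - R₁₃ vanishes by
AH₁. -/
theorem sd2_lie (h : IsAH1Coeff G) (i j : Fin 4) : ∑ m, structConst G i j m * sd2 G m
    = sd3 G i * sd1 G j - sd3 G j * sd1 G i := by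
  have e := h.ah02 i j
  simp only [curvCoeff, Fin.sum_univ_four] at e
  simp only [coeff_self h.skew, h.skew _ 1 0, h.skew _ 2 0, h.skew _ 3 0, h.skew _ 2 1,
    h.skew _ 3 1, h.skew _ 3 2] at e
  simp only [Fin.sum_univ_four, sd1, sd2, sd3]
  linear_combination -e

theorem sd3_lie (h : IsAH1Coeff G) (i j : Fin 4) : ∑ m, structConst G i j m * sd3 G m
    = sd1 G i * sd2 G j - sd1 G j * sd2 G i := by
  have e := h.ah03 i j
  simp only [curvCoeff, Fin.sum_univ_four] at e
  simp only [coeff_self h.skew, h.skew _ 1 0, h.skew _ 2 0, h.skew _ 3 0, h.skew _ 2 1,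
    h.skew _ 3 1, h.skew _ 3 2] at e
  simp only [Fin.sum_univ_four, sd1, sd2, sd3]
  linear_combination -e

theorem sd1_lie (h : IsAH1Coeff G) (i j : Fin 4) : ∑ m, structConst G i j m * sd1 G m
    = sd2 G i * sd3 G j - sd2 G j * sd3 G i - ricciForm G i j := by
  simp only [ricciForm, curvCoeff, Fin.sum_univ_four]
  simp only [coeff_self h.skew, h.skew _ 1 0, h.skew _ 2 0, h.skew _ 3 0, h.skew _ 2 1,
    h.skew _ 3 1, h.skew _ 3 2]
  simp only [sd1, sd2, sd3]
  ring

/-- Pair symmetry moves the AH₁ condition to the first two indices, so ρ is J-invariant. -/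
theorem ricciForm_02 (h : IsAH1Coeff G) : ricciForm G 0 2 = ricciForm G 1 3 := by
  simp only [ricciForm, h.pair 0 2, h.pair 1 3, h.ah02]

theorem ricciForm_03 (h : IsAH1Coeff G) : ricciForm G 0 3 = -ricciForm G 1 2 := by
  simp only [ricciForm, h.pair 0 3, h.pair 1 2, h.ah03]
  ring

theorem curvCoeff_swap_right (h : IsAH1Coeff G) (i j k l : Fin 4) :
    curvCoeff G i j k l = -curvCoeff G i j l k := by
  simp only [curvCoeff, Fin.sum_univ_four, h.skew _ l k]
  ring

/-- The Ricci curvature in the direction `b₀`. -/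
theorem ricci_00 (h : IsAH1Coeff G) :
    curvCoeff G 0 1 0 1 + curvCoeff G 0 2 0 2 + curvCoeff G 0 3 0 3
    = ricciForm G 0 1 := by
  rw [ricciForm, h.ah02, h.ah03]
  -- AH₁ has turned R₀₂₀₂ + R₀₃₀₃ into R₀₂₁₃ - R₀₃₁₂, which the Bianchi identity identifies with
  -- R₀₁₂₃.
  have e := h.cyclic 1 2 3 0
  rw [h.pair 1 2, h.pair 2 3, h.pair 3 1, h.curvCoeff_swap_right 3 0 1 2,
    h.curvCoeff_swap_right 1 0 2 3, h.curvCoeff_swap_right 2 0 3 1] at e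
  have s : ∀ i k l, curvCoeff G i 0 k l = -curvCoeff G 0 i k l := fun i k l => by
    simp only [curvCoeff, Fin.sum_univ_four, structConst]; ring
  rw [s, s, s, h.curvCoeff_swap_right 0 3 2 1, h.curvCoeff_swap_right 0 1 3 2] at e
  linarith

/-- This is d²c₂ = 0: the Jacobi identity paired with c₂, with dc₁, dc₂, dc₃ replaced through the
structure equations. -/
theorem sd3_wedge_ricciForm (h : IsAH1Coeff G) (i j k : Fin 4) : sd3 G i * ricciForm G j k
    + sd3 G j * ricciForm G k i + sd3 G k * ricciForm G i j = 0 := by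
  have a := h.jacobi i j k
  have e1 := h.sd1_lie
  have e2 := h.sd2_lie
  have e3 := h.sd3_lie
  simp only [Fin.sum_univ_four] at a e1 e2 e3
  generalize structConst G = T at *
  generalize sd1 G = c1 at *
  generalize sd2 G = c2 at *
  generalize sd3 G = c3 at *
  generalize ricciForm G = P at *
  linear_combination c2 0 * a 0 + c2 1 * a 1 + c2 2 * a 2 + c2 3 * a 3
    - (T i j 0 * e2 0 k + T i j 1 * e2 1 k + T i j 2 * e2 2 k + T i j 3 * e2 3 k)
    - (T j k 0 * e2 0 i + T j k 1 * e2 1 i + T j k 2 * e2 2 i + T j k 3 * e2 3 i)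
    - (T k i 0 * e2 0 j + T k i 1 * e2 1 j + T k i 2 * e2 2 j + T k i 3 * e2 3 j)
    - c1 k * e3 i j + c3 k * e1 i j - c1 i * e3 j k + c3 i * e1 j k - c1 j * e3 k i + c3 j * e1 k i

theorem sd2_wedge_ricciForm (h : IsAH1Coeff G) (i j k : Fin 4) : sd2 G i * ricciForm G j k
    + sd2 G j * ricciForm G k i + sd2 G k * ricciForm G i j = 0 := by
  have a := h.jacobi i j k
  have e1 := h.sd1_lie
  have e2 := h.sd2_lie
  have e3 := h.sd3_lie
  simp only [Fin.sum_univ_four] at a e1 e2 e3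
  generalize structConst G = T at *
  generalize sd1 G = c1 at *
  generalize sd2 G = c2 at *
  generalize sd3 G = c3 at *
  generalize ricciForm G = P at *
  linear_combination -(c3 0 * a 0 + c3 1 * a 1 + c3 2 * a 2 + c3 3 * a 3
    - (T i j 0 * e3 0 k + T i j 1 * e3 1 k + T i j 2 * e3 2 k + T i j 3 * e3 3 k)
    - (T j k 0 * e3 0 i + T j k 1 * e3 1 i + T j k 2 * e3 2 i + T j k 3 * e3 3 i)
    - (T k i 0 * e3 0 j + T k i 1 * e3 1 j + T k i 2 * e3 2 j + T k i 3 * e3 3 j)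
    + c1 k * e2 i j - c2 k * e1 i j + c1 i * e2 j k - c2 i * e1 j k + c1 j * e2 k i - c2 j * e1 k i)

/-- If `∇J` is concentrated in the direction `b₀`, then `b₀` is parallel and the connection is
concentrated in the direction `b₀`. -/
theorem coeff_eq_zero_of_rank_one (h : IsAH1Coeff G)
    (h2 : ∀ j, j ≠ 0 → sd2 G j = 0) (h3 : ∀ j, j ≠ 0 → sd3 G j = 0)
    (hne : sd2 G 0 ≠ 0 ∨ sd3 G 0 ≠ 0) :
    (∀ i k, G i 0 k = 0) ∧ ∀ i, i ≠ 0 → ∀ j k, G i j k = 0 := by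
  have e1 := h.sd1_lie 0 1
  have e2 := h.sd2_lie
  have e3 := h.sd3_lie
  simp only [Fin.sum_univ_four, h2 1 (by decide), h2 2 (by decide), h2 3 (by decide),
    h3 1 (by decide), h3 2 (by decide), h3 3 (by decide)] at e1 e2 e3
  have pos : 0 < sd2 G 0 ^ 2 + sd3 G 0 ^ 2 := by
    rcases hne with hne | hne <;> positivity
  have T0 : ∀ j, j ≠ 0 → structConst G 0 j 0 = 0 ∧ sd1 G j = 0 := by
    intro j hj
    have a2 := e2 0 j
    have a3 := e3 0 j
    rw [h2 j hj] at a3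
    rw [h3 j hj] at a2
    constructor <;> refine (mul_eq_zero.mp ?_).resolve_left pos.ne'
    · linear_combination sd2 G 0 * a2 + sd3 G 0 * a3
    · linear_combination -sd3 G 0 * a2 + sd2 G 0 * a3
  have T : ∀ i j, structConst G i j 0 = 0 := by
    intro i j
    by_cases hi : i = 0
    · by_cases hj : j = 0
      · rw [hi, hj, structConst_self]
      · rw [hi, (T0 j hj).1]
    · by_cases hj : j = 0
      · rw [hj, structConst_swap, (T0 i hi).1, neg_zero]
      · have a2 := e2 i j
        have a3 := e3 i j
        rw [h2 i hi, h2 j hj] at a3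
        rw [h3 i hi, h3 j hj] at a2
        refine (mul_eq_zero.mp ?_).resolve_left pos.ne'
        linear_combination sd2 G 0 * a2 + sd3 G 0 * a3
  have hP : ricciForm G 0 1 = 0 := by
    rw [T, (T0 1 (by decide)).2, (T0 2 (by decide)).2, (T0 3 (by decide)).2] at e1
    linarith
  have sym : ∀ i k, G i 0 k = G k 0 i := fun i k => by
    have := T i k
    simp only [structConst] at this
    linarith [h.skew i k 0, h.skew k i 0]
  have z : ∀ k, G 0 0 k = 0 := fun k => by rw [sym, coeff_self h.skew]
  -- Bochner argument: b⁰ is closed, so ∇b₀ is symmetric, and invariance removes the divergence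
  -- term. The Ricci curvature at b₀ is then |∇b₀|² up to sign, and it vanishes because ρ(b₀, b₁) =
  -- 0.
  have ric := h.ricci_00
  rw [hP] at ric
  simp only [curvCoeff, structConst, Fin.sum_univ_four] at ric
  simp only [coeff_self h.skew, h.skew _ 1 0, h.skew _ 2 0, h.skew _ 3 0, h.skew _ 2 1,
    h.skew _ 3 1, h.skew _ 3 2, z, sym 2 1, sym 3 1, sym 3 2] at ric
  have sq : G 1 0 1 ^ 2 + G 2 0 2 ^ 2 + G 3 0 3 ^ 2 + 2 * G 1 0 2 ^ 2 + 2 * G 1 0 3 ^ 2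
      + 2 * G 2 0 3 ^ 2 = 0 := by linear_combination ric
  have p1 := sq_nonneg (G 1 0 1)
  have p2 := sq_nonneg (G 2 0 2)
  have p3 := sq_nonneg (G 3 0 3)
  have p4 := sq_nonneg (G 1 0 2)
  have p5 := sq_nonneg (G 1 0 3)
  have p6 := sq_nonneg (G 2 0 3)
  have q1 : G 1 0 1 = 0 := (pow_eq_zero_iff two_ne_zero).1 (by linarith)
  have q2 : G 2 0 2 = 0 := (pow_eq_zero_iff two_ne_zero).1 (by linarith)
  have q3 : G 3 0 3 = 0 := (pow_eq_zero_iff two_ne_zero).1 (by linarith)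
  have q4 : G 1 0 2 = 0 := (pow_eq_zero_iff two_ne_zero).1 (by linarith)
  have q5 : G 1 0 3 = 0 := (pow_eq_zero_iff two_ne_zero).1 (by linarith)
  have q6 : G 2 0 3 = 0 := (pow_eq_zero_iff two_ne_zero).1 (by linarith)
  have Z : ∀ i k, G i 0 k = 0 := by
    intro i k
    fin_cases i <;> fin_cases k <;>
      simp [z, coeff_self h.skew, q1, q2, q3, q4, q5, q6, sym 2 1, sym 3 1, sym 3 2]
  refine ⟨Z, fun i hi => ?_⟩
  have s1 := (T0 i hi).2
  have s2 := h2 i hi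
  have s3 := h3 i hi
  simp only [sd1, sd2, sd3, Z, zero_add, zero_sub, neg_eq_zero] at s1 s2 s3
  intro j k
  fin_cases j <;> fin_cases k <;>
    simp [Z, coeff_self h.skew, s1, s2, s3, h.skew _ 1 0, h.skew _ 2 0, h.skew _ 3 0,
      h.skew _ 2 1, h.skew _ 3 1, h.skew _ 3 2]

end IsAH1Coeff

end Coefficients


/-! ### A determinant lemma for 3 × 3 matrices -/

/-- Let `M` be the real `3 × 3` matrix with rows `x`, `y`, `z`. If the second and third rows of
`M (tr M - Mᵀ)` are those of the cofactor matrix of `M`, and its first row is orthogonal to `y` and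
`z`, then `M` is singular. -/
theorem det_eq_zero_of_cofactor {x1 x2 x3 y1 y2 y3 z1 z2 z3 : ℝ}
    (hy1 : (y2 + z3) * y1 - x2 * y2 - x3 * y3 = z2 * x3 - z3 * x2)
    (hy2 : -(y1 * y1) + (x1 + z3) * y2 - y3 * y3 = z3 * x1 - z1 * x3)
    (hy3 : -(z1 * y1) - z2 * y2 + (x1 + y2) * y3 = z1 * x2 - z2 * x1)
    (hz1 : (y2 + z3) * z1 - x2 * z2 - x3 * z3 = x2 * y3 - x3 * y2)
    (hz2 : -(y1 * z1) + (x1 + z3) * z2 - y3 * z3 = x3 * y1 - x1 * y3)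
    (hz3 : -(z1 * z1) - z2 * z2 + (x1 + y2) * z3 = x1 * y2 - x2 * y1)
    (hxy : ((y2 + z3) * x1 - x2 * x2 - x3 * x3) * y1 + (-(y1 * x1) + (x1 + z3) * x2 - y3 * x3) * y2
      + (-(z1 * x1) - z2 * x2 + (x1 + y2) * x3) * y3 = 0)
    (hxz : ((y2 + z3) * x1 - x2 * x2 - x3 * x3) * z1 + (-(y1 * x1) + (x1 + z3) * x2 - y3 * x3) * z2
      + (-(z1 * x1) - z2 * x2 + (x1 + y2) * x3) * z3 = 0) :
    x1 * (y2 * z3 - y3 * z2) + x2 * (y3 * z1 - y1 * z3) + x3 * (y1 * z2 - y2 * z1) = 0 := by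
  by_contra hΔ
  -- `q1`, `q2`, `q3` say that the cofactor matrix annihilates the axial vector of the skew part of
  -- M. As M is assumed invertible, M is symmetric.
  have q3 : (y3 - z2) * (x2 * y3 - x3 * y2) + (z1 - x3) * (x3 * y1 - x1 * y3)
      + (x2 - y1) * (x1 * y2 - x2 * y1) = 0 := by
    linear_combination hxy - x1 * hy1 - x2 * hy2 - x3 * hy3
  have q2 : (y3 - z2) * (z2 * x3 - z3 * x2) + (z1 - x3) * (z3 * x1 - z1 * x3)
      + (x2 - y1) * (z1 * x2 - z2 * x1) = 0 := by
    linear_combination -hxz + x1 * hz1 + x2 * hz2 + x3 * hz3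
  have q1 : (y3 - z2) * (y2 * z3 - y3 * z2) + (z1 - x3) * (y3 * z1 - y1 * z3)
      + (x2 - y1) * (y1 * z2 - y2 * z1) = 0 := by
    linear_combination z1 * hy1 + z2 * hy2 + z3 * hy3 - y1 * hz1 - y2 * hz2 - y3 * hz3
  have a1 : y3 - z2 = 0 := (mul_eq_zero.mp
    (by linear_combination x1 * q1 + y1 * q2 + z1 * q3)).resolve_left hΔ
  have a2 : z1 - x3 = 0 := (mul_eq_zero.mp
    (by linear_combination x2 * q1 + y2 * q2 + z2 * q3)).resolve_left hΔ
  have a3 : x2 - y1 = 0 := (mul_eq_zero.mp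
    (by linear_combination x3 * q1 + y3 * q2 + z3 * q3)).resolve_left hΔ
  obtain rfl : y3 = z2 := by linarith
  obtain rfl : z1 = x3 := by linarith
  obtain rfl : x2 = y1 := by linarith
  -- For symmetric M, Cayley–Hamilton gives M(tr M - M)M = σ₂M - det M, while cofactor times M is
  -- det M. Hence σ₂M agrees with 2 det M in the second and third rows, so M is diagonal.
  have f22 : (x1 * y2 - x2 * x2 + (x1 * z3 - z1 * z1) + (y2 * z3 - y3 * y3)) * y2
      = 2 * (x1 * (y2 * z3 - y3 * y3) + x2 * (y3 * z1 - x2 * z3) + z1 * (x2 * y3 - y2 * z1)) := by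
    linear_combination x2 * hy1 + y2 * hy2 + y3 * hy3
  have f12 : (x1 * y2 - x2 * x2 + (x1 * z3 - z1 * z1) + (y2 * z3 - y3 * y3)) * x2 = 0 := by
    linear_combination x1 * hy1 + x2 * hy2 + z1 * hy3
  have f23 : (x1 * y2 - x2 * x2 + (x1 * z3 - z1 * z1) + (y2 * z3 - y3 * y3)) * y3 = 0 := by
    linear_combination z1 * hy1 + y3 * hy2 + z3 * hy3
  have f13 : (x1 * y2 - x2 * x2 + (x1 * z3 - z1 * z1) + (y2 * z3 - y3 * y3)) * z1 = 0 := by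
    linear_combination x1 * hz1 + x2 * hz2 + z1 * hz3
  have hne : x1 * y2 - x2 * x2 + (x1 * z3 - z1 * z1) + (y2 * z3 - y3 * y3) ≠ 0 := by
    intro h0
    rw [h0, zero_mul] at f22
    exact hΔ (by linarith)
  obtain rfl := (mul_eq_zero.mp f12).resolve_left hne
  obtain rfl := (mul_eq_zero.mp f23).resolve_left hne
  obtain rfl := (mul_eq_zero.mp f13).resolve_left hne
  -- For diagonal M the two remaining equations add up to 2·y2·z3 = 0.
  exact hΔ (by linear_combination x1 / 2 * hy2 + x1 / 2 * hz3)

/-! ### Linear dependence of c₂ and c₃ -/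

namespace IsAH1Coeff

variable {G : Fin 4 → Fin 4 → Fin 4 → ℝ}

/-- Since c₂∧ρ = c₃∧ρ = 0 with c₂, c₃ independent, ρ is a multiple of c₂∧c₃, and b₀ lies in the
kernel of both factors. -/
theorem ricciForm_zero_left (h : IsAH1Coeff G) (h2 : sd2 G 0 = 0) (h3 : sd3 G 0 = 0)
    {i j : Fin 4} (hne : sd2 G i * sd3 G j - sd2 G j * sd3 G i ≠ 0) (k : Fin 4) :
    ricciForm G 0 k = 0 := by
  have s : ∀ i, ricciForm G i 0 = -ricciForm G 0 i := fun i => ricciForm_swap i 0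
  have a2 := fun i j => h.sd2_wedge_ricciForm 0 i j
  have a3 := fun i j => h.sd3_wedge_ricciForm 0 i j
  simp only [h2, h3, s] at a2 a3
  refine (mul_eq_zero.mp ?_).resolve_left hne
  linear_combination sd2 G i * a3 k j - sd2 G j * a3 k i + sd3 G k * a2 j i

/-- The common kernel span(b₀, b₁) is an ideal with [b₀, b₁] ≠ 0. It turns out that b₂ and b₃
commute with this ideal although [b₂, b₃] does not, against Jacobi. -/
theorem false_of_kernel (h : IsAH1Coeff G) (h1 : sd1 G 0 = 0) (h2 : sd2 G 0 = 0)
    (h3 : sd3 G 0 = 0) (k1 : sd1 G 1 = 0) (k2 : sd2 G 1 = 0) (k3 : sd3 G 1 = 0)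
    (hd : sd2 G 2 * sd3 G 3 - sd2 G 3 * sd3 G 2 ≠ 0) : False := by
  have e2 := h.sd2_lie
  have e3 := h.sd3_lie
  have jac := h.jacobi
  simp only [Fin.sum_univ_four, h2, h3, k2, k3] at e2 e3 jac
  have K0 : ∀ k, structConst G 0 k 2 = 0 ∧ structConst G 0 k 3 = 0 := by
    intro k
    have a2 := e2 0 k
    have a3 := e3 0 k
    simp only [h1, h2, h3] at a2 a3
    constructor <;> refine (mul_eq_zero.mp ?_).resolve_left hd
    · linear_combination sd3 G 3 * a2 - sd2 G 3 * a3
    · linear_combination -sd3 G 2 * a2 + sd2 G 2 * a3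
  have K1 : ∀ k, structConst G 1 k 2 = 0 ∧ structConst G 1 k 3 = 0 := by
    intro k
    have a2 := e2 1 k
    have a3 := e3 1 k
    simp only [k1, k2, k3] at a2 a3
    constructor <;> refine (mul_eq_zero.mp ?_).resolve_left hd
    · linear_combination sd3 G 3 * a2 - sd2 G 3 * a3
    · linear_combination -sd3 G 2 * a2 + sd2 G 2 * a3
  have hc := coeff_eq_structConst h.skew
  have b2 := e2 2 3
  have b3 := e3 2 3
  have j0 := jac 0 1 2 0
  have j1 := jac 0 1 2 1
  have j2 := jac 0 1 3 0
  have j3 := jac 0 1 3 1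
  have j4 := jac 2 3 0 1
  have j5 := jac 2 3 1 0
  simp only [sd1, sd2, sd3, hc] at h1 h2 h3 k1 k2 k3 hd b2 b3
  simp only [structConst_self, structConst_swap 1 0, structConst_swap 2 0, structConst_swap 3 0,
    structConst_swap 2 1, structConst_swap 3 1, structConst_swap 3 2, (K0 _).1, (K0 _).2,
    (K1 _).1, (K1 _).2] at h1 h2 h3 k1 k2 k3 hd b2 b3 j0 j1 j2 j3 j4 j5
  generalize structConst G = T at *
  have r1 : T 2 3 0 = -2 * T 0 1 0 := by linarith
  have r2 : T 2 3 1 = -2 * T 0 1 1 := by linarith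
  have r3 : T 1 2 1 = -T 0 2 0 := by linarith
  have r4 : T 1 3 1 = -T 0 3 0 := by linarith
  rw [r1, r2] at hd b2 b3
  -- After the substitutions the determinant in `hd` is exactly |[b₀, b₁]|².
  have hN : T 0 1 0 ^ 2 + T 0 1 1 ^ 2 ≠ 0 := fun h0 => hd (by linear_combination h0)
  have r5 : T 1 2 0 = T 0 2 1 := sub_eq_zero.mp ((mul_eq_zero.mp (by
    linear_combination -2 * T 0 1 1 * b2 + 2 * T 0 1 0 * b3)).resolve_left hN)
  have r6 : T 1 3 0 = T 0 3 1 := sub_eq_zero.mp ((mul_eq_zero.mp (by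
    linear_combination -2 * T 0 1 0 * b2 - 2 * T 0 1 1 * b3)).resolve_left hN)
  rw [r3, r5] at j0 j1
  rw [r4, r6] at j2 j3
  -- On the ideal, ad b₂ and ad b₃ are now symmetric and trace-free. Being derivations of trace zero
  -- they kill [b₀, b₁] ≠ 0, and a singular matrix of this kind is zero.
  have s1 : T 0 2 0 = 0 := (mul_eq_zero.mp (by
    linear_combination T 0 1 0 * j0 - T 0 1 1 * j1)).resolve_left hN
  have s2 : T 0 2 1 = 0 := (mul_eq_zero.mp (by
    linear_combination T 0 1 1 * j0 + T 0 1 0 * j1)).resolve_left hN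
  have s3 : T 0 3 0 = 0 := (mul_eq_zero.mp (by
    linear_combination T 0 1 0 * j2 - T 0 1 1 * j3)).resolve_left hN
  have s4 : T 0 3 1 = 0 := (mul_eq_zero.mp (by
    linear_combination T 0 1 1 * j2 + T 0 1 0 * j3)).resolve_left hN
  -- [b₂, b₃] must act trivially on the ideal, yet its component there is -2[b₀, b₁].
  simp only [r1, r2, r3, r4, r5, r6, s1, s2, s3, s4] at j4 j5
  exact hN (by linear_combination (j4 - j5) / 2)

theorem false_of_rank_three (h : IsAH1Coeff G) (h1 : sd1 G 0 = 0) (h2 : sd2 G 0 = 0)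
    (h3 : sd3 G 0 = 0) (hdet : sd1 G 1 * (sd2 G 2 * sd3 G 3 - sd2 G 3 * sd3 G 2)
      + sd1 G 2 * (sd2 G 3 * sd3 G 1 - sd2 G 1 * sd3 G 3)
      + sd1 G 3 * (sd2 G 1 * sd3 G 2 - sd2 G 2 * sd3 G 1) ≠ 0) : False := by
  have P0 : ∀ k, ricciForm G 0 k = 0 := by
    by_contra! hk
    obtain ⟨k, hk⟩ := hk
    have v : ∀ i j, sd2 G i * sd3 G j - sd2 G j * sd3 G i = 0 := fun i j => by
      by_contra hne
      exact hk (h.ricciForm_zero_left h2 h3 hne k)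
    exact hdet (by linear_combination sd1 G 1 * v 2 3 + sd1 G 2 * v 3 1 + sd1 G 3 * v 1 2)
  have e1 := h.sd1_lie
  have e2 := h.sd2_lie
  have e3 := h.sd3_lie
  have jac := h.jacobi 1 2 3 0
  simp only [Fin.sum_univ_four, h1, h2, h3] at e1 e2 e3 jac
  -- `b₀` spans an ideal
  have K : ∀ k, structConst G 0 k 1 = 0 ∧ structConst G 0 k 2 = 0 ∧ structConst G 0 k 3 = 0 := by
    intro k
    have a1 := e1 0 k
    have a2 := e2 0 k
    have a3 := e3 0 k
    simp only [h1, h2, h3, P0] at a1 a2 a3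
    refine ⟨?_, ?_, ?_⟩ <;> refine (mul_eq_zero.mp ?_).resolve_left hdet
    · linear_combination (sd2 G 2 * sd3 G 3 - sd2 G 3 * sd3 G 2) * a1
        + (sd3 G 2 * sd1 G 3 - sd3 G 3 * sd1 G 2) * a2
        + (sd1 G 2 * sd2 G 3 - sd1 G 3 * sd2 G 2) * a3
    · linear_combination (sd2 G 3 * sd3 G 1 - sd2 G 1 * sd3 G 3) * a1
        + (sd3 G 3 * sd1 G 1 - sd3 G 1 * sd1 G 3) * a2
        + (sd1 G 3 * sd2 G 1 - sd1 G 1 * sd2 G 3) * a3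
    · linear_combination (sd2 G 1 * sd3 G 2 - sd2 G 2 * sd3 G 1) * a1
        + (sd3 G 1 * sd1 G 2 - sd3 G 2 * sd1 G 1) * a2
        + (sd1 G 1 * sd2 G 2 - sd1 G 2 * sd2 G 1) * a3
  have w2 := h.sd2_wedge_ricciForm 1 2 3
  have w3 := h.sd3_wedge_ricciForm 1 2 3
  -- the quotient by `b₀` is unimodular
  have uni : ∀ σ12 σ23 σ31 : ℝ,
      structConst G 1 2 1 * (-σ31) + structConst G 1 2 2 * σ23
      + structConst G 2 3 2 * (-σ12) + structConst G 2 3 3 * σ31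
      + structConst G 3 1 1 * σ12 + structConst G 3 1 3 * (-σ23) = 0 := by
    intro σ12 σ23 σ31
    -- Every 2-form σ on the quotient is a combination of the cᵢ∧cⱼ. These are closed by the
    -- structure equations and c₂∧ρ = c₃∧ρ = 0, so dσ = 0.
    refine (mul_eq_zero.mp ?_).resolve_left hdet
    generalize structConst G = T at *
    generalize sd1 G = x at *
    generalize sd2 G = y at *
    generalize sd3 G = z at *
    generalize ricciForm G = P at *
    linear_combination (x 1 * σ23 + x 2 * σ31 + x 3 * σ12) * (z 3 * e2 1 2 - y 3 * e3 1 2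
        + z 1 * e2 2 3 - y 1 * e3 2 3 + z 2 * e2 3 1 - y 2 * e3 3 1)
      + (y 1 * σ23 + y 2 * σ31 + y 3 * σ12) * (x 3 * e3 1 2 - z 3 * e1 1 2
        + x 1 * e3 2 3 - z 1 * e1 2 3 + x 2 * e3 3 1 - z 2 * e1 3 1 + w3)
      + (z 1 * σ23 + z 2 * σ31 + z 3 * σ12) * (y 3 * e1 1 2 - x 3 * e2 1 2
        + y 1 * e1 2 3 - x 1 * e2 2 3 + y 2 * e1 3 1 - x 2 * e2 3 1 - w2)
  -- With σ the b₀-component of the bracket, dσ = 0 differs from Jacobi only by products of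
  -- b₀-components of [bᵢ, bⱼ] and [b₀, bₖ]. The vanishing of the cᵢ at b₀ turns these into a sum of
  -- squares.
  have u := uni (structConst G 1 2 0) (structConst G 2 3 0) (structConst G 3 1 0)
  have hc := coeff_eq_structConst h.skew
  have d1 := h1
  have d2 := h2
  have d3 := h3
  simp only [sd1, sd2, sd3, hc] at d1 d2 d3
  simp only [structConst_self, structConst_swap 1 0, structConst_swap 2 0, structConst_swap 3 0,
    structConst_swap 2 1, structConst_swap 3 1, structConst_swap 3 2, (K _).1, (K _).2.1,
    (K _).2.2] at d1 d2 d3 jac u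
  have t1 : structConst G 2 3 0 = -2 * structConst G 0 1 0 := by linarith
  have t2 : structConst G 1 3 0 = 2 * structConst G 0 2 0 := by linarith
  have t3 : structConst G 1 2 0 = -2 * structConst G 0 3 0 := by linarith
  rw [t1, t2, t3] at jac u
  have sq : structConst G 0 1 0 ^ 2 + structConst G 0 2 0 ^ 2 + structConst G 0 3 0 ^ 2 = 0 := by
    linear_combination (u - jac) / 2
  have p1 := sq_nonneg (structConst G 0 1 0)
  have p2 := sq_nonneg (structConst G 0 2 0)
  have p3 := sq_nonneg (structConst G 0 3 0)
  have z1 : structConst G 0 1 0 = 0 := (pow_eq_zero_iff two_ne_zero).1 (by linarith)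
  have z2 : structConst G 0 2 0 = 0 := (pow_eq_zero_iff two_ne_zero).1 (by linarith)
  have z3 : structConst G 0 3 0 = 0 := (pow_eq_zero_iff two_ne_zero).1 (by linarith)
  rw [z1, mul_zero] at t1
  rw [z2, mul_zero] at t2
  rw [z3, mul_zero] at t3
  -- hence `b₀` is parallel
  have Z : ∀ i k, G i 0 k = 0 := by
    intro i k
    rw [hc]
    fin_cases i <;> fin_cases k <;>
      simp [structConst_self, structConst_swap 1 0, structConst_swap 2 0, structConst_swap 3 0,
        structConst_swap 2 1, structConst_swap 3 1, structConst_swap 3 2, K, z1, z2, z3, t1, t2, t3]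
  have S1 : ∀ i, sd1 G i = G i 2 3 := fun i => by rw [sd1, Z, zero_add]
  have S2 : ∀ i, sd2 G i = -G i 1 3 := fun i => by rw [sd2, Z, zero_sub]
  have S3 : ∀ i, sd3 G i = G i 1 2 := fun i => by rw [sd3, Z, zero_add]
  have v23 := e1 2 3
  have v31 := e1 3 1
  have v12 := e1 1 2
  have y1 := e2 2 3
  have y2 := e2 3 1
  have y3 := e2 1 2
  have x1 := e3 2 3
  have x2 := e3 3 1
  have x3 := e3 1 2
  simp only [structConst, S1, S2, S3] at hdet w2 w3 v12 v23 v31 y1 y2 y3 x1 x2 x3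
  simp only [coeff_self h.skew, h.skew _ 2 1, h.skew _ 3 1, h.skew _ 3 2]
    at hdet w2 w3 v12 v23 v31 y1 y2 y3 x1 x2 x3
  refine hdet ?_
  -- The rows are c₁, c₂, c₃ on b₁, b₂, b₃. The cofactor equations are those for dc₂ and dc₃; the
  -- orthogonality conditions are c₂∧ρ = c₃∧ρ = 0 with ρ eliminated through dc₁.
  have := det_eq_zero_of_cofactor (x1 := G 1 2 3) (x2 := G 2 2 3) (x3 := G 3 2 3)
    (y1 := -G 1 1 3) (y2 := -G 2 1 3) (y3 := -G 3 1 3)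
    (z1 := G 1 1 2) (z2 := G 2 1 2) (z3 := G 3 1 2)
    (by linear_combination y1) (by linear_combination y2) (by linear_combination y3)
    (by linear_combination x1) (by linear_combination x2) (by linear_combination x3)
    (by linear_combination -G 1 1 3 * v23 - G 2 1 3 * v31 - G 3 1 3 * v12 - w2)
    (by linear_combination G 1 1 2 * v23 + G 2 1 2 * v31 + G 3 1 2 * v12 - w3)
  linear_combination this

theorem false_of_rank_two (h : IsAH1Coeff G) (h1 : sd1 G 0 = 0) (h2 : sd2 G 0 = 0)
    (h3 : sd3 G 0 = 0) {i j : Fin 4} (hne : sd2 G i * sd3 G j - sd2 G j * sd3 G i ≠ 0)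
    (hdet : sd1 G 1 * (sd2 G 2 * sd3 G 3 - sd2 G 3 * sd3 G 2)
      + sd1 G 2 * (sd2 G 3 * sd3 G 1 - sd2 G 1 * sd3 G 3)
      + sd1 G 3 * (sd2 G 1 * sd3 G 2 - sd2 G 2 * sd3 G 1) = 0) : False := by
  have P0 := h.ricciForm_zero_left h2 h3 hne
  have P13 : ricciForm G 1 3 = 0 := by rw [← h.ricciForm_02, P0]
  have P12 : ricciForm G 1 2 = 0 := by linarith [h.ricciForm_03, P0 3]
  -- the Ricci form does not vanish, hence `b₁` is in the kernel of the self-dual part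
  have P23 : ricciForm G 2 3 ≠ 0 := by
    intro P23
    have P : ∀ k l, ricciForm G k l = 0 := by
      have s := fun i j => ricciForm_swap (G := G) i j
      have d : ∀ i, ricciForm G i i = 0 := fun i => by linarith [s i i]
      intro k l
      fin_cases k <;> fin_cases l <;> simp only [Fin.zero_eta, Fin.mk_one, Fin.reduceFinMk]
      all_goals first
        | simp only [P0, P12, P13, P23, d]
        | rw [s]; simp only [P0, P12, P13, P23, neg_zero]
    have e1 := h.sd1_lie
    have e2 := h.sd2_lie
    have e3 := h.sd3_lie
    simp only [Fin.sum_univ_four, P, sub_zero] at e1 e2 e3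
    obtain ⟨α, β, hαβ⟩ : ∃ α β, ∀ k, sd1 G k = α * sd2 G k + β * sd3 G k := by
      have : ∀ k, (sd2 G i * sd3 G j - sd2 G j * sd3 G i) * sd1 G k
          = (sd1 G i * sd3 G j - sd1 G j * sd3 G i) * sd2 G k
            + (sd2 G i * sd1 G j - sd2 G j * sd1 G i) * sd3 G k := by
        intro k
        fin_cases i <;> fin_cases j <;> fin_cases k <;>
          simp only [Fin.zero_eta, Fin.mk_one, Fin.reduceFinMk, h1, h2, h3] <;>
          first | ring1 | linear_combination hdet | linear_combination -hdet
      refine ⟨(sd1 G i * sd3 G j - sd1 G j * sd3 G i) / (sd2 G i * sd3 G j - sd2 G j * sd3 G i),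
        (sd2 G i * sd1 G j - sd2 G j * sd1 G i) / (sd2 G i * sd3 G j - sd2 G j * sd3 G i),
        fun k => ?_⟩
      rw [div_mul_eq_mul_div, div_mul_eq_mul_div, ← add_div, eq_div_iff hne]
      linear_combination this k
    -- With ρ = 0, inserting c₁ = αc₂ + βc₃ into the structure equations gives c₂∧c₃ = -(α² + β²)
    -- c₂∧c₃.
    refine hne ((mul_eq_zero.mp (?_ : (1 + α ^ 2 + β ^ 2) * _ = 0)).resolve_left (by positivity))
    have a1 := e1 i j
    have a2 := e2 i j
    have a3 := e3 i j
    simp only [hαβ] at a1 a2 a3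
    linear_combination -a1 + α * a2 + β * a3
  have k2 : sd2 G 1 = 0 := by
    have := h.sd2_wedge_ricciForm 1 2 3
    rw [P12, ricciForm_swap 3 1, P13] at this
    exact (mul_eq_zero.mp (by linear_combination this)).resolve_right P23
  have k3 : sd3 G 1 = 0 := by
    have := h.sd3_wedge_ricciForm 1 2 3
    rw [P12, ricciForm_swap 3 1, P13] at this
    exact (mul_eq_zero.mp (by linear_combination this)).resolve_right P23
  have hd : sd2 G 2 * sd3 G 3 - sd2 G 3 * sd3 G 2 ≠ 0 := by
    intro hd
    apply hne
    fin_cases i <;> fin_cases j <;>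
      simp only [Fin.zero_eta, Fin.mk_one, Fin.reduceFinMk, h2, h3, k2, k3] <;>
      linarith
  have k1 : sd1 G 1 = 0 := by
    rw [k2, k3] at hdet
    exact (mul_eq_zero.mp (by linear_combination hdet)).resolve_right hd
  exact h.false_of_kernel h1 h2 h3 k1 k2 k3 hd

/-- The forms `sd2` and `sd3` are linearly dependent if the self-dual part of the connection
vanishes at `b₀`. -/
theorem sd2_wedge_sd3 (h : IsAH1Coeff G) (h1 : sd1 G 0 = 0) (h2 : sd2 G 0 = 0) (h3 : sd3 G 0 = 0)
    (i j : Fin 4) : sd2 G i * sd3 G j - sd2 G j * sd3 G i = 0 := by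
  by_contra hne
  by_cases hdet : sd1 G 1 * (sd2 G 2 * sd3 G 3 - sd2 G 3 * sd3 G 2)
      + sd1 G 2 * (sd2 G 3 * sd3 G 1 - sd2 G 1 * sd3 G 3)
      + sd1 G 3 * (sd2 G 1 * sd3 G 2 - sd2 G 2 * sd3 G 1) = 0
  · exact h.false_of_rank_two h1 h2 h3 hne hdet
  · exact h.false_of_rank_three h1 h2 h3 hdet

end IsAH1Coeff

/-! ### Orthonormal and unitary frames -/

section Frames

variable {V : Type*} [AddCommGroup V] [Module ℝ V]

/-- `b` is an orthonormal basis for `g`. -/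
def IsOrthonormal (g : Metric V) (b : Module.Basis (Fin 4) ℝ V) : Prop :=
  ∀ i j, g.form (b i) (b j) = if i = j then 1 else 0

namespace IsOrthonormal

variable {g : Metric V} {b : Module.Basis (Fin 4) ℝ V}

theorem repr_eq (hb : IsOrthonormal g b) (x : V) (i : Fin 4) : b.repr x i = g.form x (b i) := by
  conv_rhs => rw [← b.sum_repr x]
  rw [map_sum, LinearMap.sum_apply]
  simp only [map_smul, LinearMap.smul_apply, smul_eq_mul, hb _ _]
  simp

theorem sum_eq (hb : IsOrthonormal g b) (x : V) : ∑ i, g.form x (b i) • b i = x := by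
  simp only [← hb.repr_eq, b.sum_repr]

theorem form_eq (hb : IsOrthonormal g b) (x y : V) :
    g.form x y = ∑ i, g.form x (b i) * g.form y (b i) := by
  conv_lhs => rw [← hb.sum_eq y]
  simp [mul_comm]

theorem ext_form (hb : IsOrthonormal g b) {x y : V} (h : ∀ i, g.form x (b i) = g.form y (b i)) :
    x = y := by
  rw [← hb.sum_eq x, ← hb.sum_eq y]
  simp only [h]

theorem trace_eq (hb : IsOrthonormal g b) (f : V →ₗ[ℝ] V) :
    LinearMap.trace ℝ V f = ∑ i, g.form (f (b i)) (b i) := by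
  rw [LinearMap.trace_eq_matrix_trace ℝ b f, Matrix.trace]
  simp only [Matrix.diag_apply, LinearMap.toMatrix_apply, hb.repr_eq]

end IsOrthonormal

theorem exists_basis_of_orthonormal (hV : Module.finrank ℝ V = 4) (g : Metric V) (v : Fin 4 → V)
    (hv : ∀ i j, g.form (v i) (v j) = if i = j then 1 else 0) :
    ∃ b : Module.Basis (Fin 4) ℝ V, IsOrthonormal g b ∧ ∀ i, b i = v i := by
  have li : LinearIndependent ℝ v := by
    rw [Fintype.linearIndependent_iff]
    intro c hc i
    have := congrArg (fun x => g.form x (v i)) hc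
    simpa [hv] using this
  have hcard : Fintype.card (Fin 4) = Module.finrank ℝ V := by simp [hV]
  have e : ∀ i, basisOfLinearIndependentOfCardEqFinrank li hcard i = v i := fun i => by simp
  exact ⟨_, fun i j => by rw [e, e, hv], e⟩

theorem Metric.exists_smul_unit (g : Metric V) {w : V} (hw : w ≠ 0) :
    ∃ r : ℝ, 0 < r ∧ g.form (r • w) (r • w) = 1 := by
  have hp := g.pos w hw
  refine ⟨(Real.sqrt (g.form w w))⁻¹, by positivity, ?_⟩
  simp only [map_smul, LinearMap.smul_apply, smul_eq_mul]
  rw [← mul_assoc, ← mul_inv, Real.mul_self_sqrt hp.le, inv_mul_cancel₀ hp.ne']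

theorem exists_unit_of_functionals [FiniteDimensional ℝ V] (hV : Module.finrank ℝ V = 4)
    (g : Metric V) (f : V →ₗ[ℝ] (Fin 3 → ℝ)) : ∃ w, g.form w w = 1 ∧ f w = 0 := by
  have hk : LinearMap.ker f ≠ ⊥ := LinearMap.ker_ne_bot_of_finrank_lt (by simp [hV])
  obtain ⟨w, hw, hw0⟩ := Submodule.exists_mem_ne_zero_of_ne_bot hk
  obtain ⟨r, -, hr⟩ := g.exists_smul_unit hw0
  exact ⟨r • w, hr, by rw [map_smul, LinearMap.mem_ker.mp hw, smul_zero]⟩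

theorem exists_unit_orthogonal [FiniteDimensional ℝ V] (hV : Module.finrank ℝ V = 4)
    (g : Metric V) (x y z : V) :
    ∃ w, g.form w w = 1 ∧ g.form x w = 0 ∧ g.form y w = 0 ∧ g.form z w = 0 := by
  obtain ⟨w, hw, h0⟩ := exists_unit_of_functionals hV g
    (LinearMap.pi ![g.form x, g.form y, g.form z])
  exact ⟨w, hw, congrFun h0 0, congrFun h0 1, congrFun h0 2⟩

/-- An orthonormal basis of the form `b₀, b₁ = J b₀, b₂, b₃ = J b₂`. -/
structure IsUnitary (g : Metric V) (J : V →ₗ[ℝ] V) (b : Module.Basis (Fin 4) ℝ V) : Prop where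
  ortho : IsOrthonormal g b
  map0 : J (b 0) = b 1
  map2 : J (b 2) = b 3

theorem exists_isUnitary [FiniteDimensional ℝ V] (hV : Module.finrank ℝ V = 4) {g : Metric V}
    {J : V →ₗ[ℝ] V} (hJ : IsCompatible g J) {u : V} (hu : g.form u u = 1) :
    ∃ b, IsUnitary g J b ∧ b 0 = u := by
  obtain ⟨w, hw, h1, h2, -⟩ := exists_unit_orthogonal hV g u (J u) 0
  have hw1 : g.form w u = 0 := by rw [g.symm, h1]
  have hw2 : g.form w (J u) = 0 := by rw [g.symm, h2]
  have s := hJ.form_self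
  have s' : ∀ x, g.form x (J x) = 0 := fun x => by rw [g.symm, s]
  obtain ⟨b, hb, hv⟩ := exists_basis_of_orthonormal hV g ![u, J u, w, J w] (by
    intro i j
    fin_cases i <;> fin_cases j <;>
      simp [hJ.orthogonal, hu, hw, h1, h2, hw1, hw2, s, s', hJ.form_left w u]
    rw [g.symm, hJ.form_left, hw2, neg_zero])
  exact ⟨b, ⟨hb, by simp [hv], by simp [hv]⟩, by simp [hv]⟩

theorem IsUnitary.map1 {g : Metric V} {J : V →ₗ[ℝ] V} {b : Module.Basis (Fin 4) ℝ V}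
    (hb : IsUnitary g J b) (hJ : IsCompatible g J) : J (b 1) = -b 0 := by
  rw [← hb.map0, hJ.sq]

theorem IsUnitary.map3 {g : Metric V} {J : V →ₗ[ℝ] V} {b : Module.Basis (Fin 4) ℝ V}
    (hb : IsUnitary g J b) (hJ : IsCompatible g J) : J (b 3) = -b 2 := by
  rw [← hb.map2, hJ.sq]

end Frames

/-! ### From the Lie algebra to frame coefficients, and the adapted frame -/

section Coefficients

variable {𝔤 : Type*} [LieRing 𝔤] [LieAlgebra ℝ 𝔤] [FiniteDimensional ℝ 𝔤]

/-- The coefficients of the Levi-Civita connection in a frame. -/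
noncomputable def connCoeff (g : Metric 𝔤) (b : Module.Basis (Fin 4) ℝ 𝔤) (i j k : Fin 4) : ℝ :=
  g.form (conn g (b i) (b j)) (b k)

variable {g : Metric 𝔤} {b : Module.Basis (Fin 4) ℝ 𝔤}

theorem structConst_connCoeff (i j k : Fin 4) :
    structConst (connCoeff g b) i j k = g.form ⁅b i, b j⁆ (b k) := by
  simp only [structConst, connCoeff, lie_eq_conn g, map_sub, LinearMap.sub_apply]

theorem IsOrthonormal.lie_eq (hb : IsOrthonormal g b) (i j : Fin 4) :
    ⁅b i, b j⁆ = ∑ m, structConst (connCoeff g b) i j m • b m := by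
  simp only [structConst_connCoeff, hb.sum_eq]

theorem IsOrthonormal.form_lie_lie (hb : IsOrthonormal g b) (i j k l : Fin 4) :
    ∑ m, structConst (connCoeff g b) i j m * structConst (connCoeff g b) m k l
      = g.form ⁅⁅b i, b j⁆, b k⁆ (b l) := by
  rw [hb.lie_eq i j, sum_lie, map_sum, LinearMap.sum_apply]
  simp only [smul_lie, map_smul, LinearMap.smul_apply, smul_eq_mul, structConst_connCoeff _ k l]

theorem IsOrthonormal.curvCoeff_eq (hb : IsOrthonormal g b) (i j k l : Fin 4) :
    curvCoeff (connCoeff g b) i j k l = curvatureTensor g (b i) (b j) (b k) (b l) := by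
  rw [curvatureTensor_eq, hb.lie_eq i j, hb.form_eq (conn g (b i) (b k)),
    hb.form_eq (conn g (b j) (b k)), curvCoeff, Finset.sum_sub_distrib]
  simp only [map_sum, map_smul, LinearMap.sum_apply, LinearMap.smul_apply, smul_eq_mul, connCoeff]

theorem IsOrthonormal.form_conn_eq (hb : IsOrthonormal g b) (x : 𝔤) (j k : Fin 4) :
    g.form (conn g x (b j)) (b k) = ∑ m, g.form x (b m) * connCoeff g b m j k := by
  conv_lhs => rw [← hb.sum_eq x]
  simp only [map_sum, map_smul, LinearMap.sum_apply, LinearMap.smul_apply, smul_eq_mul, connCoeff]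

theorem IsOrthonormal.sd2_eq (hb : IsOrthonormal g b) (x : 𝔤) :
    g.form (conn g x (b 0)) (b 2) - g.form (conn g x (b 1)) (b 3)
      = ∑ m, g.form x (b m) * sd2 (connCoeff g b) m := by
  simp only [hb.form_conn_eq, sd2, Fin.sum_univ_four]
  ring

theorem IsOrthonormal.sd3_eq (hb : IsOrthonormal g b) (x : 𝔤) :
    g.form (conn g x (b 0)) (b 3) + g.form (conn g x (b 1)) (b 2)
      = ∑ m, g.form x (b m) * sd3 (connCoeff g b) m := by
  simp only [hb.form_conn_eq, sd3, Fin.sum_univ_four]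
  ring

theorem isAH1Coeff_connCoeff {J : 𝔤 →ₗ[ℝ] 𝔤} (hJ : IsCompatible g J) (hA : IsAH1 g J)
    (hb : IsUnitary g J b) : IsAH1Coeff (connCoeff g b) where
  skew i j k := form_conn_left g _ _ _
  jacobi i j k l := by
    simp only [Finset.sum_add_distrib, hb.ortho.form_lie_lie, ← LinearMap.add_apply, ← map_add]
    have := lie_jacobi (b i) (b j) (b k)
    rw [← lie_skew (b i) ⁅b j, b k⁆, ← lie_skew (b j) ⁅b k, b i⁆,
      ← lie_skew (b k) ⁅b i, b j⁆] at this
    have e : ⁅⁅b i, b j⁆, b k⁆ + ⁅⁅b j, b k⁆, b i⁆ + ⁅⁅b k, b i⁆, b j⁆ = 0 := by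
      rw [← neg_eq_zero, ← this]; abel
    rw [e, map_zero, LinearMap.zero_apply]
  cyclic i j k l := by simp only [hb.ortho.curvCoeff_eq, curvatureTensor_cyclic]
  pair i j k l := by simp only [hb.ortho.curvCoeff_eq]; exact curvatureTensor_pair g _ _ _ _
  ah02 i j := by
    simp only [hb.ortho.curvCoeff_eq]
    rw [hA, hb.map0, hb.map2]
  ah03 i j := by
    simp only [hb.ortho.curvCoeff_eq]
    rw [hA, hb.map0, hb.map3 hJ, curvatureTensor, map_neg, curvatureTensor]

theorem IsUnitary.isParallelAlong_iff {J : 𝔤 →ₗ[ℝ] 𝔤} (hJ : IsCompatible g J)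
    (hb : IsUnitary g J b) (x : 𝔤) : IsParallelAlong g J x ↔
      g.form (conn g x (b 0)) (b 2) - g.form (conn g x (b 1)) (b 3) = 0 ∧
      g.form (conn g x (b 0)) (b 3) + g.form (conn g x (b 1)) (b 2) = 0 := by
  constructor
  · intro h
    rw [← hb.map0, ← hb.map2, h, hJ.orthogonal, hJ.form_left]
    constructor <;> ring
  · rintro ⟨h2, h3⟩
    have s := form_conn_left g x
    have z : ∀ i, g.form (conn g x (b i)) (b i) = 0 := fun i => by linarith [s (b i) (b i)]
    have e : (conn g x).comp J = J.comp (conn g x) := by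
      refine b.ext fun i => hb.ortho.ext_form fun j => ?_
      simp only [LinearMap.comp_apply, hJ.form_left]
      fin_cases i <;> fin_cases j <;>
        simp only [Fin.zero_eta, Fin.mk_one, Fin.reduceFinMk, hb.map0, hb.map2, hb.map1 hJ,
          hb.map3 hJ, map_neg, LinearMap.neg_apply, neg_neg, neg_inj, z, neg_zero, s (b 1) (b 0),
          s (b 2) (b 0), s (b 3) (b 0), s (b 2) (b 1), s (b 3) (b 1), s (b 3) (b 2)] <;>
        linarith
    exact fun y => LinearMap.congr_fun e y

/-- Shows that c₁(x) does not depend on the unitary frame, so its vanishing survives a change of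
frame. -/
theorem IsUnitary.trace_comp_conn {J : 𝔤 →ₗ[ℝ] 𝔤} (hJ : IsCompatible g J)
    (hb : IsUnitary g J b) (x : 𝔤) : LinearMap.trace ℝ 𝔤 (J.comp (conn g x))
      = -2 * (g.form (conn g x (b 0)) (b 1) + g.form (conn g x (b 2)) (b 3)) := by
  rw [hb.ortho.trace_eq, Fin.sum_univ_four]
  simp only [LinearMap.comp_apply, hJ.form_left, hb.map0, hb.map2, hb.map1 hJ, hb.map3 hJ,
    map_neg, form_conn_left g x (b 1) (b 0), form_conn_left g x (b 3) (b 2)]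
  ring

theorem isKahler_of_sd_eq_zero {J : 𝔤 →ₗ[ℝ] 𝔤} (hJ : IsCompatible g J) (hb : IsUnitary g J b)
    (h : ∀ i, sd2 (connCoeff g b) i = 0 ∧ sd3 (connCoeff g b) i = 0) : IsKahler g J := by
  refine isKahler_of_parallel hJ fun x => ?_
  have hi := fun i => (hb.isParallelAlong_iff hJ (b i)).mpr (h i)
  intro y
  rw [← b.sum_repr x]
  simp only [map_sum, map_smul, LinearMap.sum_apply, LinearMap.smul_apply, hi _ y]

/-- In dimension four, a non-Kähler `AH₁`-structure admits a unitary frame in which the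
Levi-Civita connection is `e⁰ ⊗ A`, with `A b₀ = 0`. -/
theorem exists_adapted_frame (hdim : Module.finrank ℝ 𝔤 = 4) {J : 𝔤 →ₗ[ℝ] 𝔤}
    (hJ : IsCompatible g J) (hA : IsAH1 g J) (hK : ¬ IsKahler g J) :
    ∃ b, IsUnitary g J b ∧ (∀ i k, connCoeff g b i 0 k = 0) ∧
      (∀ i, i ≠ 0 → ∀ j k, connCoeff g b i j k = 0) ∧
      (sd2 (connCoeff g b) 0 ≠ 0 ∨ sd3 (connCoeff g b) 0 ≠ 0) := by
  obtain ⟨u₀, hu₀, -⟩ := exists_unit_of_functionals hdim g 0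
  obtain ⟨b₀, hb₀, -⟩ := exists_isUnitary hdim hJ hu₀
  let f (i j : Fin 4) : 𝔤 →ₗ[ℝ] ℝ := (g.form.flip (b₀ j)).comp ((conn g).flip (b₀ i))
  -- A common zero of c₁, c₂, c₃ computed in an arbitrary unitary frame; it becomes the first vector
  -- of the next frame.
  obtain ⟨u₁, hu₁, hc⟩ := exists_unit_of_functionals hdim g
    (LinearMap.pi ![f 0 1 + f 2 3, f 0 2 - f 1 3, f 0 3 + f 1 2])
  have c1 : g.form (conn g u₁ (b₀ 0)) (b₀ 1) + g.form (conn g u₁ (b₀ 2)) (b₀ 3) = 0 :=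
    congrFun hc 0
  have c23 : IsParallelAlong g J u₁ :=
    (hb₀.isParallelAlong_iff hJ u₁).mpr ⟨congrFun hc 1, congrFun hc 2⟩
  obtain ⟨b₁, hb₁, rfl⟩ := exists_isUnitary hdim hJ hu₁
  have hG := isAH1Coeff_connCoeff hJ hA hb₁
  have k1 : sd1 (connCoeff g b₁) 0 = 0 := by
    have t := hb₀.trace_comp_conn hJ (b₁ 0)
    rw [c1, hb₁.trace_comp_conn hJ (b₁ 0)] at t
    simp only [sd1, connCoeff]
    linarith
  have k23 := (hb₁.isParallelAlong_iff hJ (b₁ 0)).mp c23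
  have hw := hG.sd2_wedge_sd3 k1 k23.1 k23.2
  -- a vector whose orthogonal complement consists of directions along which `J` is parallel
  obtain ⟨n, hn0, hn⟩ : ∃ n : 𝔤, n ≠ 0 ∧ ∀ x, g.form n x = 0 → IsParallelAlong g J x := by
    have hx := fun x => hb₁.isParallelAlong_iff hJ x
    simp only [hb₁.ortho.sd2_eq, hb₁.ortho.sd3_eq] at hx
    obtain ⟨i, hi⟩ : ∃ i, sd2 (connCoeff g b₁) i ≠ 0 ∨ sd3 (connCoeff g b₁) i ≠ 0 := by
      by_contra! h0
      exact hK (isKahler_of_sd_eq_zero hJ hb₁ h0)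
    have dual : ∀ (c : Fin 4 → ℝ) x, g.form (∑ m, c m • b₁ m) x = ∑ m, g.form x (b₁ m) * c m := by
      intro c x
      simp only [map_sum, LinearMap.sum_apply, map_smul, LinearMap.smul_apply, smul_eq_mul,
        g.symm x, mul_comm]
    have nz : ∀ c : Fin 4 → ℝ, c i ≠ 0 → ∑ m, c m • b₁ m ≠ 0 := fun c hc h0 =>
      hc (Fintype.linearIndependent_iff.mp b₁.linearIndependent c h0 i)
    rcases hi with hi | hi
    -- n is the metric dual of whichever of c₂, c₃ is nonzero; c₂∧c₃ = 0 makes the other form vanish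
    -- on n^⊥ as well.
    · refine ⟨_, nz _ hi, fun x h0 => (hx x).mpr ?_⟩
      rw [dual] at h0
      refine ⟨h0, (mul_eq_zero.mp ?_).resolve_left hi⟩
      rw [Fin.sum_univ_four] at h0 ⊢
      linear_combination sd3 (connCoeff g b₁) i * h0 + g.form x (b₁ 0) * hw i 0
        + g.form x (b₁ 1) * hw i 1 + g.form x (b₁ 2) * hw i 2 + g.form x (b₁ 3) * hw i 3
    · refine ⟨_, nz _ hi, fun x h0 => (hx x).mpr ?_⟩
      rw [dual] at h0
      refine ⟨(mul_eq_zero.mp ?_).resolve_left hi, h0⟩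
      rw [Fin.sum_univ_four] at h0 ⊢
      linear_combination sd2 (connCoeff g b₁) i * h0 - g.form x (b₁ 0) * hw i 0
        - g.form x (b₁ 1) * hw i 1 - g.form x (b₁ 2) * hw i 2 - g.form x (b₁ 3) * hw i 3
  obtain ⟨r, hr, hru⟩ := g.exists_smul_unit hn0
  obtain ⟨b, hb, hbn⟩ := exists_isUnitary hdim hJ hru
  have hG := isAH1Coeff_connCoeff hJ hA hb
  have hp : ∀ j, j ≠ 0 → IsParallelAlong g J (b j) := by
    intro j hj
    have := hb.ortho 0 j
    rw [if_neg hj.symm, hbn, map_smul, LinearMap.smul_apply, smul_eq_mul] at this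
    exact hn _ ((mul_eq_zero.mp this).resolve_left hr.ne')
  have h2 : ∀ j, j ≠ 0 → sd2 (connCoeff g b) j = 0 := fun j hj =>
    ((hb.isParallelAlong_iff hJ (b j)).mp (hp j hj)).1
  have h3 : ∀ j, j ≠ 0 → sd3 (connCoeff g b) j = 0 := fun j hj =>
    ((hb.isParallelAlong_iff hJ (b j)).mp (hp j hj)).2
  have hne : sd2 (connCoeff g b) 0 ≠ 0 ∨ sd3 (connCoeff g b) 0 ≠ 0 := by
    by_contra! h0
    refine hK (isKahler_of_sd_eq_zero hJ hb fun i => ?_)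
    by_cases hi : i = 0
    · rw [hi]; exact h0
    · exact ⟨h2 i hi, h3 i hi⟩
  obtain ⟨z1, z2⟩ := hG.coeff_eq_zero_of_rank_one h2 h3 hne
  exact ⟨b, hb, z1, z2, hne⟩

end Coefficients


/-! ### Identification of the algebra, flatness, and non-Kähler structures -/

section Classification

variable {𝔤 : Type*} [LieRing 𝔤] [LieAlgebra ℝ 𝔤]

/-- A Lie algebra with a basis in which `ad b₀` acts as a nonzero rotation on `b₁, b₂, b₃` and the
other brackets vanish is isomorphic to `A_{3,6} ⊕ A_1`. -/
theorem nonempty_lieEquiv_of_basis (b : Module.Basis (Fin 4) ℝ 𝔤) (A : 𝔤 →ₗ[ℝ] 𝔤)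
    {v1 v2 v3 : ℝ} (hv : v2 ≠ 0 ∨ v3 ≠ 0)
    (hlie : ∀ x y, ⁅x, y⁆ = b.repr x 0 • A y - b.repr y 0 • A x)
    (h0 : A (b 0) = 0) (h1 : A (b 1) = v3 • b 2 - v2 • b 3) (h2 : A (b 2) = v1 • b 3 - v3 • b 1)
    (h3 : A (b 3) = v2 • b 1 - v1 • b 2) : Nonempty (𝔤 ≃ₗ⁅ℝ⁆ A36A1) := by
  have hs : 0 < v2 ^ 2 + v3 ^ 2 := by rcases hv with hv | hv <;> positivity
  obtain ⟨l, hl, hl2⟩ : ∃ l : ℝ, 0 < l ∧ l ^ 2 = v1 ^ 2 + v2 ^ 2 + v3 ^ 2 :=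
    ⟨Real.sqrt (v1 ^ 2 + v2 ^ 2 + v3 ^ 2), Real.sqrt_pos.mpr (by linarith [sq_nonneg v1]),
      Real.sq_sqrt (by positivity)⟩
  -- On b₁, b₂, b₃ the map A is the cross product with v = (v1, v2, v3), and l = |v|. Here e₄ goes
  -- to the axis v, e₁ to b₁ × v, e₂ to A(b₁ × v)/l and e₃ to b₀/l.
  let φ : A36A1 →ₗ[ℝ] 𝔤 :=
    { toFun x := (x.c3 / l) • b 0 + (x.c2 / l * (v2 ^ 2 + v3 ^ 2) + x.c4 * v1) • b 1
        + (-x.c1 * v3 - x.c2 / l * (v1 * v2) + x.c4 * v2) • b 2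
        + (x.c1 * v2 - x.c2 / l * (v1 * v3) + x.c4 * v3) • b 3
      map_add' x y := by
        simp only [A36A1.add_def]
        module
      map_smul' c x := by
        simp only [A36A1.smul_def, RingHom.id_apply]
        module }
  have hφ : ∀ x, φ x = (x.c3 / l) • b 0 + (x.c2 / l * (v2 ^ 2 + v3 ^ 2) + x.c4 * v1) • b 1
        + (-x.c1 * v3 - x.c2 / l * (v1 * v2) + x.c4 * v2) • b 2
        + (x.c1 * v2 - x.c2 / l * (v1 * v3) + x.c4 * v3) • b 3 := fun x => rfl
  have r0 : ∀ x, b.repr (φ x) 0 = x.c3 / l := fun x => by simp [hφ]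
  have r1 : ∀ x, b.repr (φ x) 1 = x.c2 / l * (v2 ^ 2 + v3 ^ 2) + x.c4 * v1 := fun x => by
    simp [hφ]
  have r2 : ∀ x, b.repr (φ x) 2 = -x.c1 * v3 - x.c2 / l * (v1 * v2) + x.c4 * v2 := fun x => by
    simp [hφ]
  have r3 : ∀ x, b.repr (φ x) 3 = x.c1 * v2 - x.c2 / l * (v1 * v3) + x.c4 * v3 := fun x => by
    simp [hφ]
  have hA : ∀ x, A (φ x) = φ ⟨-l * x.c2, l * x.c1, 0, 0⟩ := by
    intro x
    simp only [hφ, map_add, map_smul, h0, h1, h2, h3]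
    match_scalars
    · field_simp
      linear_combination (-x.c2 * v3) * hl2
    · field_simp
      linear_combination (x.c2 * v2) * hl2
    all_goals
      field_simp
      ring
  let Φ : A36A1 →ₗ⁅ℝ⁆ 𝔤 :=
    { φ with
      map_lie' := by
        intro x y
        change φ ⁅x, y⁆ = ⁅φ x, φ y⁆
        rw [hlie, r0, r0, hA, hA, ← map_smul, ← map_smul, ← map_sub]
        congr 1
        rw [sub_eq_add_neg, A36A1.lie_def]
        simp only [A36A1.smul_def, A36A1.neg_def, A36A1.add_def]
        ext <;> simp only <;> field_simp <;> ring }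
  have inj : Function.Injective φ := by
    rw [← LinearMap.ker_eq_bot, LinearMap.ker_eq_bot']
    intro x hx
    have z := fun i => congrArg (fun y => b.repr y i) hx
    have z0 := z 0
    have z1 := z 1
    have z2 := z 2
    have z3 := z 3
    simp only [r0, r1, r2, r3, map_zero, Finsupp.coe_zero, Pi.zero_apply] at z0 z1 z2 z3
    have w1 : x.c1 = 0 := (mul_eq_zero.mp
      (by linear_combination -v3 * z2 + v2 * z3)).resolve_left hs.ne'
    have w4 : x.c4 = 0 := (mul_eq_zero.mp (by
      rw [hl2]
      linear_combination v1 * z1 + v2 * z2 + v3 * z3)).resolve_left (pow_pos hl 2).ne'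
    have w2 : x.c2 = 0 := by
      rw [w4, zero_mul, add_zero] at z1
      simpa [hl.ne', hs.ne'] using z1
    have w3 : x.c3 = 0 := by simpa [hl.ne'] using z0
    exact A36A1.ext w1 w2 w3 w4
  have hfd : FiniteDimensional ℝ 𝔤 := Module.Basis.finiteDimensional_of_finite b
  have hdim : Module.finrank ℝ A36A1 = Module.finrank ℝ 𝔤 := by
    rw [A36A1.finrank_eq, Module.finrank_eq_card_basis b, Fintype.card_fin]
  have bij : Function.Bijective Φ :=
    ⟨inj, (LinearMap.injective_iff_surjective_of_finrank_eq_finrank hdim).mp inj⟩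
  exact ⟨(LieEquiv.ofBijective Φ bij).symm⟩

variable [FiniteDimensional ℝ 𝔤]

/-- A four-dimensional Lie algebra with a non-Kähler `AH₁`-structure is isomorphic to
`A_{3,6} ⊕ A_1`, and the metric of the structure is flat. -/
theorem isFlat_and_nonempty_lieEquiv (hdim : Module.finrank ℝ 𝔤 = 4) {g : Metric 𝔤}
    {J : 𝔤 →ₗ[ℝ] 𝔤} (hJ : IsCompatible g J) (hA : IsAH1 g J) (hK : ¬ IsKahler g J) :
    IsFlat g ∧ Nonempty (𝔤 ≃ₗ⁅ℝ⁆ A36A1) := by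
  obtain ⟨b, hb, z1, z2, hne⟩ := exists_adapted_frame hdim hJ hA hK
  have skew := (isAH1Coeff_connCoeff hJ hA hb).skew
  have hconn : ∀ x y, conn g x y = b.repr x 0 • conn g (b 0) y := by
    have : conn g = (b.coord 0).smulRight (conn g (b 0)) := by
      refine b.ext fun i => ?_
      by_cases hi : i = 0
      · subst hi; simp
      · have h0 : conn g (b i) = 0 := b.ext fun j => hb.ortho.ext_form fun k => by
          simpa [connCoeff] using z2 i hi j k
        simp [h0, hi]
    intro x y
    conv_lhs => rw [this]
    rfl
  have hlie : ∀ x y, ⁅x, y⁆ = b.repr x 0 • conn g (b 0) y - b.repr y 0 • conn g (b 0) x := by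
    intro x y
    rw [lie_eq_conn g, hconn x y, hconn y x]
  have h0 : conn g (b 0) (b 0) = 0 := hb.ortho.ext_form fun k => by
    simpa [connCoeff] using z1 0 k
  have hr : ∀ y, b.repr (conn g (b 0) y) 0 = 0 := fun y => by
    rw [hb.ortho.repr_eq, form_conn_left, h0, map_zero, LinearMap.zero_apply, neg_zero]
  constructor
  · intro x y z
    -- All ∇ₓ are multiples of one operator, so they commute, and ∇ along [x, y] vanishes because
    -- brackets have no b₀-component.
    rw [curvature_eq_conn, hconn x, hconn y (conn g x z), hconn ⁅x, y⁆ z, hconn y z, hconn x z,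
      hlie x y]
    simp only [map_sub, map_smul, Finsupp.sub_apply, Finsupp.smul_apply, hr]
    module
  · have e : ∀ j, conn g (b 0) (b j) = ∑ k, connCoeff g b 0 j k • b k := fun j =>
      (hb.ortho.sum_eq _).symm
    -- Through `hne`, v2 and v3 are c₂(b₀) and c₃(b₀); as b₀ is parallel these are entries of A.
    refine nonempty_lieEquiv_of_basis b (conn g (b 0)) (v1 := connCoeff g b 0 2 3) hne hlie h0
      ?_ ?_ ?_ <;>
    · rw [e]
      simp only [Fin.sum_univ_four, sd2, sd3, z1, coeff_self skew, skew _ 1 0, skew _ 2 0,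
        skew _ 3 0, skew _ 2 1, skew _ 3 1, skew _ 3 2]
      module

theorem isAH1_of_isFlat {g : Metric 𝔤} (hg : IsFlat g) (J : 𝔤 →ₗ[ℝ] 𝔤) : IsAH1 g J := by
  intro x y z w
  simp only [curvatureTensor, hg _ _ _, map_zero, LinearMap.zero_apply]

/-- If the derived algebra is not contained in the line of a central vector, then every metric has
a compatible almost complex structure whose fundamental form is not closed. -/
theorem exists_isCompatible_not_isKahler (hdim : Module.finrank ℝ 𝔤 = 4) (g : Metric 𝔤) {z : 𝔤}
    (hz : z ≠ 0) (hcen : ∀ x : 𝔤, ⁅x, z⁆ = 0) {x y : 𝔤} (hxy : ∀ r : ℝ, ⁅x, y⁆ ≠ r • z) :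
    ∃ J : 𝔤 →ₗ[ℝ] 𝔤, IsCompatible g J ∧ ¬ IsKahler g J := by
  obtain ⟨r, hr, hu⟩ := g.exists_smul_unit hz
  obtain ⟨u, hu_def⟩ : ∃ u, u = r • z := ⟨_, rfl⟩
  rw [← hu_def] at hu
  have hcu : ∀ x : 𝔤, ⁅x, u⁆ = 0 := fun x => by rw [hu_def, lie_smul, hcen, smul_zero]
  have hw0 : ⁅x, y⁆ - g.form ⁅x, y⁆ u • u ≠ 0 := by
    rw [sub_ne_zero, hu_def, smul_smul]
    exact hxy _
  have horth : g.form u (⁅x, y⁆ - g.form ⁅x, y⁆ u • u) = 0 := by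
    rw [map_sub, map_smul, smul_eq_mul, hu, g.symm u, mul_one, sub_self]
  obtain ⟨q, hq, hv⟩ := g.exists_smul_unit hw0
  obtain ⟨v, hv_def⟩ : ∃ v, v = q • (⁅x, y⁆ - g.form ⁅x, y⁆ u • u) := ⟨_, rfl⟩
  rw [← hv_def] at hv
  have huv : g.form u v = 0 := by rw [hv_def, map_smul, horth, smul_zero]
  have hpos : g.form ⁅x, y⁆ v ≠ 0 := by
    intro h0
    have e := congrArg (fun w => g.form w v) hv_def
    simp [hv, h0, huv] at e
  obtain ⟨s, hs, hus, hvs, -⟩ := exists_unit_orthogonal hdim g u v 0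
  obtain ⟨t, ht, hut, hvt, hst⟩ := exists_unit_orthogonal hdim g u v s
  obtain ⟨b, hb, hbv⟩ := exists_basis_of_orthonormal hdim g ![u, v, s, t] (by
    intro i j
    fin_cases i <;> fin_cases j <;>
      simp [hu, hv, hs, ht, huv, hus, hvs, hut, hvt, hst, g.symm v u, g.symm s u, g.symm s v,
        g.symm t u, g.symm t v, g.symm t s])
  -- J sends the central unit vector u to v, the normalised part of [x, y] orthogonal to u. Then
  -- dω(x, y, u) = -ω([x, y], u) = g([x, y], v) ≠ 0.
  let J : 𝔤 →ₗ[ℝ] 𝔤 := b.constr ℝ ![b 1, -b 0, b 3, -b 2]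
  have j0 : J (b 0) = b 1 := by simp [J]
  have j1 : J (b 1) = -b 0 := by simp [J]
  have j2 : J (b 2) = b 3 := by simp [J]
  have j3 : J (b 3) = -b 2 := by simp [J]
  have hJ : IsCompatible g J := by
    constructor
    · have : J.comp J = -LinearMap.id := by
        refine b.ext fun i => ?_
        fin_cases i <;> simp [j0, j1, j2, j3]
      exact fun x => LinearMap.congr_fun this x
    · have : g.form.compl₁₂ J J = g.form := by
        refine LinearMap.BilinForm.ext_basis b fun i j => ?_
        fin_cases i <;> fin_cases j <;> simp [j0, j1, j2, j3, hb _ _]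
      exact fun x y => LinearMap.congr_fun₂ this x y
  refine ⟨J, hJ, fun hK => hpos ?_⟩
  have h := hK.2 x y u
  have b0 : b 0 = u := by simp [hbv]
  have b1 : b 1 = v := by simp [hbv]
  rw [b0, b1] at j0
  rw [dOmega, hcu, ← lie_skew u x, hcu, neg_zero, omega, omega, omega, hJ.form_left, j0] at h
  simpa using h

end Classification

/-! ### The model algebra -/

namespace A36A1

theorem nabla_stdMetric (x y : A36A1) :
    nabla stdMetric x y = ⟨-(x.c3 * y.c2), x.c3 * y.c1, 0, 0⟩ := by
  refine stdMetric.ext_form fun z => ?_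
  rw [form_nabla]
  simp only [stdMetric, LinearMap.mk₂_apply, lie_def]
  ring

theorem isFlat_stdMetric : IsFlat stdMetric := by
  intro x y z
  simp only [curvature, nabla_stdMetric, lie_def, sub_eq_add_neg, neg_def, add_def]
  ext <;> simp only [zero_def] <;> ring

theorem exists_not_isKahler {𝔤 : Type*} [LieRing 𝔤] [LieAlgebra ℝ 𝔤] [FiniteDimensional ℝ 𝔤]
    (e : 𝔤 ≃ₗ⁅ℝ⁆ A36A1) (g : Metric 𝔤) :
    ∃ J : 𝔤 →ₗ[ℝ] 𝔤, IsCompatible g J ∧ ¬ IsKahler g J := by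
  refine exists_isCompatible_not_isKahler (e.toLinearEquiv.finrank_eq.trans finrank_eq) g
    (z := e.symm ⟨0, 0, 0, 1⟩) (x := e.symm ⟨0, 1, 0, 0⟩) (y := e.symm ⟨0, 0, 1, 0⟩) ?_ ?_ ?_
  · intro h
    have h' := congrArg (fun x => (e x).c4) h
    simp [zero_def] at h'
  · intro x
    refine (show Function.Injective e from e.injective) ?_
    rw [LieEquiv.map_lie, LieEquiv.apply_symm_apply, map_zero]
    simp [lie_def, zero_def]
  · intro r h
    have h' := congrArg (fun x => (e x).c1) h
    simp [LieEquiv.map_lie, lie_def, smul_def] at h'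

end A36A1

/-! ### Transport along Lie algebra isomorphisms -/

section Transport

variable {𝔤 𝔥 : Type*} [LieRing 𝔤] [LieAlgebra ℝ 𝔤] [LieRing 𝔥] [LieAlgebra ℝ 𝔥]

/-- The pullback of a metric along an isomorphism of Lie algebras. -/
def Metric.pullback (g : Metric 𝔥) (e : 𝔤 ≃ₗ⁅ℝ⁆ 𝔥) : Metric 𝔤 where
  form := g.form.compl₁₂ (e : 𝔤 →ₗ[ℝ] 𝔥) (e : 𝔤 →ₗ[ℝ] 𝔥)
  symm _ _ := g.symm _ _
  pos _ hx := g.pos _ fun h => hx (e.injective (h.trans (map_zero e).symm))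

theorem Metric.pullback_form (g : Metric 𝔥) (e : 𝔤 ≃ₗ⁅ℝ⁆ 𝔥) (x y : 𝔤) :
    (g.pullback e).form x y = g.form (e x) (e y) := rfl

variable [FiniteDimensional ℝ 𝔤] [FiniteDimensional ℝ 𝔥]

theorem map_nabla_pullback (g : Metric 𝔥) (e : 𝔤 ≃ₗ⁅ℝ⁆ 𝔥) (x y : 𝔤) :
    e (nabla (g.pullback e) x y) = nabla g (e x) (e y) := by
  refine g.ext_form fun z => ?_
  obtain ⟨z, rfl⟩ : ∃ z', e z' = z := ⟨e.symm z, e.apply_symm_apply z⟩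
  rw [← g.pullback_form e, form_nabla, form_nabla]
  simp only [Metric.pullback_form, LieEquiv.map_lie]

theorem isFlat_pullback {g : Metric 𝔥} (hg : IsFlat g) (e : 𝔤 ≃ₗ⁅ℝ⁆ 𝔥) :
    IsFlat (g.pullback e) := by
  intro x y z
  refine (show Function.Injective e from e.injective) ?_
  rw [map_zero, ← hg (e x) (e y) (e z)]
  simp only [curvature, map_sub, map_nabla_pullback, LieEquiv.map_lie]

/-- `AH₁`-structures that are flat and not Kähler exist on every isomorphic copy of
`A_{3,6} ⊕ A_1`. -/
theorem exists_isAH1_not_isKahler (e : 𝔤 ≃ₗ⁅ℝ⁆ A36A1) :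
    ∃ (g : Metric 𝔤) (J : 𝔤 →ₗ[ℝ] 𝔤), IsCompatible g J ∧ IsAH1 g J ∧ ¬ IsKahler g J := by
  obtain ⟨J, hJ, hK⟩ := A36A1.exists_not_isKahler e (A36A1.stdMetric.pullback e)
  exact ⟨_, J, hJ, isAH1_of_isFlat (isFlat_pullback A36A1.isFlat_stdMetric e) J, hK⟩

end Transport

end LieAH

theorem theorem6p1 :
    (∀ (𝔤 : Type*) [LieRing 𝔤] [LieAlgebra ℝ 𝔤] [FiniteDimensional ℝ 𝔤],
      Module.finrank ℝ 𝔤 = 4 →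
        ((∃ (g : Metric 𝔤) (J : 𝔤 →ₗ[ℝ] 𝔤),
            IsCompatible g J ∧ IsAH1 g J ∧ ¬ IsKahler g J) ↔
          Nonempty (𝔤 ≃ₗ⁅ℝ⁆ A36A1))) ∧
    IsFlat A36A1.stdMetric ∧
    (∀ (g : Metric A36A1) (J : A36A1 →ₗ[ℝ] A36A1), IsCompatible g J →
      ((IsAH1 g J ∧ ¬ IsKahler g J) ↔ (IsFlat g ∧ ¬ IsKahler g J))) ∧
    (∀ g : Metric A36A1, IsFlat g →
      ∃ J : A36A1 →ₗ[ℝ] A36A1, IsCompatible g J ∧ ¬ IsKahler g J) := by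
  refine ⟨fun 𝔤 _ _ _ hdim => ⟨?_, ?_⟩, A36A1.isFlat_stdMetric, fun g J hJ => ⟨?_, ?_⟩,
    fun g _ => A36A1.exists_not_isKahler LieEquiv.refl g⟩
  · rintro ⟨g, J, hJ, hA, hK⟩
    exact (isFlat_and_nonempty_lieEquiv hdim hJ hA hK).2
  · rintro ⟨e⟩
    exact exists_isAH1_not_isKahler e
  · rintro ⟨hA, hK⟩
    exact ⟨(isFlat_and_nonempty_lieEquiv A36A1.finrank_eq hJ hA hK).1, hK⟩
  · rintro ⟨hF, hK⟩
    exact ⟨isAH1_of_isFlat hF J, hK⟩
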